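/- Let $\kappa>0$ and let $AdS^{3,1}=\{y\in\mathbb R^{3,2}:\ -(y^0)^2-(y^4)^2+\sum_{i=1}^3(y^i)^2=-1/\kappa\}$ with the metric induced from $-(dy^0)^2-(dy^4)^2+\sum_{i=1}^3(dy^i)^2$; its universal covering, in static coordinates $(t,x)$ with $r=|x|$, is $\mathbb R^4$ with the metric $-(1+\kappa r^2)\,dt^2+\frac{dr^2}{1+\kappa r^2}+r^2(d\theta^2+\sin^2\theta\,d\phi^2)$. The linear map sending $M\in \underline{so}(3,2)$ to the vector field $y\mapsto My$ is a bijection of $\underline{so}(3,2)$ onto the space of Killing fields of $AdS^{3,1}$, and Killing fields are regarded as elements of $\underline{so}(3,2)$ in this way. Write $(A,\vec B,\vec C,\vec D)$ for the Killing field $$A\Big(y^0\frac{\partial}{\partial y^4}-y^4\frac{\partial}{\partial y^0}\Big)+B_i\Big(y^0\frac{\partial}{\partial y^i}+y^i\frac{\partial}{\partial y^0}\Big)+C_j\Big(y^4\frac{\partial}{\partial y^j}+y^j\frac{\partial}{\partial y^4}\Big)+D_p\,\epsilon_{pqr}\,y^q\frac{\partial}{\partial y^r},$$ and choose the time orientation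 for which $(1,\vec 0,\vec 0,\vec 0)$, a positive multiple of $\partial/\partial t$, is future directed. A Killing field $K$ is an observer Killing field if it is hypersurface orthogonal, everywhere future timelike, and $\min(-\langle K,K\rangle)=1$; let $\mathcal O$ be the set of these. The spinor bundle (on the universal covering) is the trivial $\mathbb C^4$-bundle associated with the static orthonormal frame $e_0,e_1,e_2,e_3$, where $e_0$ is the unit vector along $\partial_t$ and $e_i=\partial_{x^i}+\frac{\kappa x^i}{1+\sqrt{1+\kappa r^2}}\,x^j\partial_{x^j}$, which at the base point $t=0$, $x=0$ (that is, $y^0=1/\sqrt\kappa$, $y^i=y^4=0$) is $\partial/\partial y^4,\partial/\partial y^1,\partial/\partial y^2,\partial/\partial y^3$; $e_a$ acts by Clifford multiplication through the gamma matrix $\gamma_a$, where, in $2\times2$ blocks, $\gamma_0=\begin{pmatrix}0&I\\I&0\end{pmatrix}$ and $\gamma_j=\begin{pmatrix}0&\sigma_j\\-\sigma_j&0\end{pmatrix}$ with $\sigma_1=\begin{pmatrix}1&0\\0&-1\end{pmatrix}$, $\sigma_2=\begin{pmatrix}0&1\\1&0\end{pmatrix}$, $\sigma_3=\begin{pmatrix}0&-i\\i&0\end{pmatrix}$.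 On $\mathbb C^4=\mathbb C^2\times\mathbb C^2$ put $((v_1,v_2),(u_1,u_2))=\langle v_1,u_2\rangle+\langle v_2,u_1\rangle$. An imaginary Killing spinor is a smooth spinor field $\psi$ with $\nabla_X\psi=\frac i2\sqrt\kappa\,X.\psi$ for all $X$, where $\nabla$ is the spinor connection. A Killing field $K$ is a spinor Killing field if there is an imaginary Killing spinor $\psi$ with $\langle K,X\rangle=-(X.\psi,\psi)$ for all tangent vectors $X$; let $\mathcal S$ be the set of these. **Theorem.** The convex hull of $\mathcal O$ in $\underline{so}(3,2)$ is properly contained in the convex hull of $\mathcal S$. Every $K\in\mathcal O$ is a finite linear combination, with positive coefficients, of elements of $\mathcal S$. The Killing field $(3,(-1,0,0),(-2,0,0),(2,0,0))$ belongs to $\mathcal S$ but not to the convex hull of $\mathcal O$. -/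

import Mathlib

open scoped ContDiff Matrix

noncomputable section

namespace AdS

/-- The ambient space `ℝ^{3,2}`: the coordinates `y¹, y², y³` are indexed by `inl 0, inl 1, inl 2`,
the coordinate `y⁰` by `inr 0` and the coordinate `y⁴` by `inr 1`. -/
abbrev Ambient : Type := Fin 3 ⊕ Fin 2 → ℝ

/-- The metric `(dy¹)² + (dy²)² + (dy³)² - (dy⁰)² - (dy⁴)²` of `ℝ^{3,2}`. -/
def eta (u v : Ambient) : ℝ :=
  ∑ i, u (Sum.inl i) * v (Sum.inl i) - ∑ a, u (Sum.inr a) * v (Sum.inr a)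

/-- Anti-de Sitter spacetime of curvature `-κ`: the hyperboloid `⟨y, y⟩ = -1/κ` in `ℝ^{3,2}`,
with the induced metric. -/
def Spacetime (κ : ℝ) : Set Ambient := {y | eta y y = -1 / κ}

/-- `X` is tangent to the hyperboloid at the point `y`. -/
def IsTangent (y X : Ambient) : Prop := eta y X = 0

/-! ### Killing fields -/

/-- `V` is a Killing field: it is tangent, smooth (i.e. the restriction of a smooth map of the
ambient space; the hyperboloid is a closed submanifold), and `(L_V g)(X, Y) =
⟨∇_X V, Y⟩ + ⟨X, ∇_Y V⟩` vanishes for all tangent `X, Y`. The Levi-Civita derivative `∇_X V` is the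
tangential part of the ambient derivative of `V` along `X`; the normal part drops out of the
products with tangent vectors. -/
def IsKilling (κ : ℝ) (V : Spacetime κ → Ambient) : Prop :=
  (∀ y : Spacetime κ, IsTangent y (V y)) ∧
  ∃ W : Ambient → Ambient, ContDiff ℝ ∞ W ∧ (∀ y : Spacetime κ, W y = V y) ∧
    ∀ (y : Spacetime κ) (X Y : Ambient), IsTangent y X → IsTangent y Y →
      eta (fderiv ℝ W y X) Y + eta X (fderiv ℝ W y Y) = 0

/-- The vector space underlying the Lie algebra `so(3,2)`: the matrices that are skew-adjoint with
respect to `diag(1, 1, 1, -1, -1)`. -/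
abbrev so32 : Submodule ℝ (Matrix (Fin 3 ⊕ Fin 2) (Fin 3 ⊕ Fin 2) ℝ) :=
  skewAdjointMatricesSubmodule (LieAlgebra.Orthogonal.indefiniteDiagonal (Fin 3) (Fin 2) ℝ)

/-- The vector field `y ↦ M y` on the hyperboloid given by `M ∈ so(3,2)`. -/
def field (κ : ℝ) : so32 →ₗ[ℝ] (Spacetime κ → Ambient) where
  toFun M := fun y => M.1 *ᵥ y.1
  map_add' M N := by
    funext y
    simp [Matrix.add_mulVec]
  map_smul' c M := by
    funext y
    simp [Matrix.smul_mulVec]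

/-- The vector at `y` of
`A (y⁰∂₄ - y⁴∂₀) + Bᵢ (y⁰∂ᵢ + yⁱ∂₀) + Cⱼ (y⁴∂ⱼ + yʲ∂₄) + D_p ε_{pqr} y^q ∂_r`. -/
def coordVector (A : ℝ) (B C D : Fin 3 → ℝ) (y : Ambient) : Ambient :=
  Sum.elim
    (fun i => B i * y (Sum.inr 0) + C i * y (Sum.inr 1) + (D ⨯₃ fun q => y (Sum.inl q)) i)
    ![-A * y (Sum.inr 1) + ∑ i, B i * y (Sum.inl i),
      A * y (Sum.inr 0) + ∑ i, C i * y (Sum.inl i)]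

/-- The matrix of the linear map `coordVector A B C D`. -/
def coordMatrix (A : ℝ) (B C D : Fin 3 → ℝ) : Matrix (Fin 3 ⊕ Fin 2) (Fin 3 ⊕ Fin 2) ℝ :=
  Matrix.of fun i j => coordVector A B C D (Pi.single j 1) i

theorem coordMatrix_mem (A : ℝ) (B C D : Fin 3 → ℝ) : coordMatrix A B C D ∈ so32 := by
  rw [mem_skewAdjointMatricesSubmodule, Matrix.IsSkewAdjoint, Matrix.IsAdjointPair]
  ext i j
  rcases i with i | i <;> rcases j with j | j <;> fin_cases i <;> fin_cases j <;>
    simp [coordMatrix, coordVector, LieAlgebra.Orthogonal.indefiniteDiagonal, Matrix.mul_apply,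
      Matrix.transpose_apply, crossProduct, Fin.sum_univ_three, Pi.single_apply]

/-- The element `(A, B, C, D)` of `so(3,2)`. -/
def coord (A : ℝ) (B C D : Fin 3 → ℝ) : so32 := ⟨coordMatrix A B C D, coordMatrix_mem A B C D⟩

theorem field_coord (κ A : ℝ) (B C D : Fin 3 → ℝ) (y : Spacetime κ) :
    field κ (coord A B C D) y = coordVector A B C D y := by
  ext i
  rcases i with i | i <;> fin_cases i <;>
    simp [field, coord, coordMatrix, coordVector, Matrix.mulVec, dotProduct, crossProduct,
      Fin.sum_univ_three, Pi.single_apply] <;> ring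

/-! ### Observer Killing fields -/

/-- `V` is hypersurface orthogonal: near every point of the spacetime there is a smooth function
`f`, without critical points on the spacetime, such that `V` is orthogonal to the level
hypersurfaces of `f`. -/
def IsHypersurfaceOrthogonal (κ : ℝ) (V : Spacetime κ → Ambient) : Prop :=
  ∀ y : Spacetime κ, ∃ U : Set Ambient, IsOpen U ∧ (y : Ambient) ∈ U ∧
    ∃ f : Ambient → ℝ, ContDiffOn ℝ ∞ f U ∧ ∀ z : Spacetime κ, (z : Ambient) ∈ U →
      (∃ X, IsTangent z X ∧ fderiv ℝ f z X ≠ 0) ∧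
      ∀ X, IsTangent z X → fderiv ℝ f z X = 0 → eta (V z) X = 0

/-- `V` is everywhere timelike and future pointing; the time orientation is the one for which the
time translation field `∂/∂t`, a positive multiple of `y⁰∂₄ - y⁴∂₀`, is future pointing. -/
def IsFutureTimelike (κ : ℝ) (V : Spacetime κ → Ambient) : Prop :=
  ∀ y : Spacetime κ, eta (V y) (V y) < 0 ∧ eta (V y) (coordVector 1 0 0 0 y) < 0

/-- `V` is an observer Killing field. -/
def IsObserverKilling (κ : ℝ) (V : Spacetime κ → Ambient) : Prop :=
  IsKilling κ V ∧ IsHypersurfaceOrthogonal κ V ∧ IsFutureTimelike κ V ∧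
    IsLeast (Set.range fun y : Spacetime κ => -eta (V y) (V y)) 1

/-! ### Spinors -/

/-- The gamma matrices: `γ₀² = 1`, `γᵢ² = -1`, so that `X.X. = -⟨X, X⟩`. -/
def gamma : Fin 4 → Matrix (Fin 4) (Fin 4) ℂ :=
  ![!![0, 0, 1, 0; 0, 0, 0, 1; 1, 0, 0, 0; 0, 1, 0, 0],
    !![0, 0, 1, 0; 0, 0, 0, -1; -1, 0, 0, 0; 0, 1, 0, 0],
    !![0, 0, 0, 1; 0, 0, 1, 0; 0, -1, 0, 0; -1, 0, 0, 0],
    !![0, 0, 0, -Complex.I; 0, 0, Complex.I, 0; 0, Complex.I, 0, 0; -Complex.I, 0, 0, 0]]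

/-- The invariant form `((v₁, v₂), (u₁, u₂)) = ⟨v₁, u₂⟩ + ⟨v₂, u₁⟩` on `ℂ⁴ = ℂ² × ℂ²`, conjugate
linear in the second argument. -/
def spinForm (v u : Fin 4 → ℂ) : ℂ :=
  v 0 * star (u 2) + v 1 * star (u 3) + v 2 * star (u 0) + v 3 * star (u 1)

/-- The parameter space of the static coordinates `(t, x)`, with `r = |x|`. -/
abbrev Static : Type := ℝ × (Fin 3 → ℝ)

/-- The lapse `√(1 + κ r²)`. -/
def lapse (κ : ℝ) (p : Static) : ℝ := √(1 + κ * ∑ i, p.2 i ^ 2)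

/-- The static coordinates, as a map `ℝ⁴ → ℝ^{3,2}`: it is the universal covering of the hyperboloid
and the induced metric is `-(1 + κ r²) dt² + dr² / (1 + κ r²) + r² dΩ²`. It takes the origin to the
base point `y⁰ = 1/√κ`, `yⁱ = y⁴ = 0`. -/
def chart (κ : ℝ) (p : Static) : Ambient :=
  Sum.elim p.2
    ![lapse κ p / √κ * Real.cos (√κ * p.1), lapse κ p / √κ * Real.sin (√κ * p.1)]

theorem chart_mem {κ : ℝ} (hκ : 0 < κ) (p : Static) : chart κ p ∈ Spacetime κ := by
  have hs : 0 ≤ ∑ i, p.2 i ^ 2 := Finset.sum_nonneg fun i _ => sq_nonneg _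
  have hl : lapse κ p ^ 2 = 1 + κ * ∑ i, p.2 i ^ 2 :=
    Real.sq_sqrt (by positivity)
  have hk : √κ ^ 2 = κ := Real.sq_sqrt hκ.le
  have ht := Real.sin_sq_add_cos_sq (√κ * p.1)
  have h1 : (lapse κ p / √κ) ^ 2 = 1 / κ + ∑ i, p.2 i ^ 2 := by
    rw [div_pow, hl, hk]
    field_simp
  have h2 : ∑ i, p.2 i * p.2 i = ∑ i, p.2 i ^ 2 := by simp only [sq]
  simp only [Spacetime, Set.mem_ofPred_eq, eta, chart, Sum.elim_inl, Sum.elim_inr,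
    Fin.sum_univ_two, Matrix.cons_val_zero, Matrix.cons_val_one, h2]
  rw [neg_div]
  linear_combination -(lapse κ p / √κ) ^ 2 * ht - h1

/-- The static orthonormal frame along the chart, as vectors of the ambient space tangent to the
hyperboloid: `e₀` is the unit vector along `∂/∂t`, and
`eᵢ = ∂ᵢ + κ xᵢ / (1 + √(1 + κ r²)) · xʲ ∂ⱼ` in the coordinates `(t, x)`. At the origin it is
`∂/∂y⁴, ∂/∂y¹, ∂/∂y², ∂/∂y³`. -/
def frame (κ : ℝ) (p : Static) : Fin 4 → Ambient :=
  Fin.cons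
    (Sum.elim 0 ![-Real.sin (√κ * p.1), Real.cos (√κ * p.1)])
    fun i => Sum.elim
      (Pi.single i 1 + (κ * p.2 i / (1 + lapse κ p)) • p.2)
      ![√κ * p.2 i * Real.cos (√κ * p.1), √κ * p.2 i * Real.sin (√κ * p.1)]

/-- The signs `⟨e_a, e_a⟩`. -/
def sign : Fin 4 → ℝ := ![-1, 1, 1, 1]

/-- The `a`-th component of the coordinate vector `v` at `p` in the orthonormal frame. -/
def coframe (κ : ℝ) (p v : Static) (a : Fin 4) : ℝ :=
  sign a * eta (fderiv ℝ (chart κ) p v) (frame κ p a)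

/-- The connection coefficients `⟨∇_v e_a, e_b⟩` of the Levi-Civita connection. -/
def connection (κ : ℝ) (p v : Static) (a b : Fin 4) : ℝ :=
  eta (fderiv ℝ (fun q => frame κ q a) p v) (frame κ p b)

/-- Clifford multiplication `v.ψ` of a spinor at `p` by a tangent vector. The spinor bundle is
trivialized by the static frame, the frame vector `e_a` acting by `γ_a`. -/
def clifford (κ : ℝ) (p v : Static) (s : Fin 4 → ℂ) : Fin 4 → ℂ :=
  ∑ a, (coframe κ p v a : ℂ) • (gamma a *ᵥ s)

/-- The spinor connection
`∇_v ψ = v(ψ) + (1/4) ∑_{a,b} ⟨∇_v e_a, e_b⟩ γᵃ γᵇ ψ`, with `γᵃ = ⟨e_a, e_a⟩ γ_a`. -/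
def spinDeriv (κ : ℝ) (ψ : Static → Fin 4 → ℂ) (p v : Static) : Fin 4 → ℂ :=
  fderiv ℝ ψ p v + (1 / 4 : ℂ) • ∑ a, ∑ b,
    ((sign a * sign b * connection κ p v a b : ℝ) : ℂ) • (gamma a *ᵥ (gamma b *ᵥ ψ p))

/-- `ψ` is an imaginary Killing spinor: `∇_X ψ = (i/2) √κ X.ψ`. -/
def IsKillingSpinor (κ : ℝ) (ψ : Static → Fin 4 → ℂ) : Prop :=
  ContDiff ℝ ∞ ψ ∧ ∀ p v : Static,
    spinDeriv κ ψ p v = (Complex.I / 2 * (√κ : ℂ)) • clifford κ p v (ψ p)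

/-- `V` is a spinor Killing field: a Killing field with `⟨V, X⟩ = -(X.ψ, ψ)` for an imaginary Killing
spinor `ψ` and all tangent vectors `X`. -/
def IsSpinorKilling (κ : ℝ) (V : Spacetime κ → Ambient) : Prop :=
  IsKilling κ V ∧ ∃ ψ : Static → Fin 4 → ℂ, IsKillingSpinor κ ψ ∧
    ∀ (y : Spacetime κ) (p v : Static), chart κ p = y →
      ((eta (V y) (fderiv ℝ (chart κ) p v) : ℝ) : ℂ) = -spinForm (clifford κ p v (ψ p)) (ψ p)

/-! ### The two subsets of `so(3,2)` -/

/-- The set `𝒪` of observer Killing fields, as a subset of `so(3,2)`. -/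
def observerSet (κ : ℝ) : Set so32 := {M | IsObserverKilling κ (field κ M)}

/-- The set `𝒮` of spinor Killing fields, as a subset of `so(3,2)`. -/
def spinorSet (κ : ℝ) : Set so32 := {M | IsSpinorKilling κ (field κ M)}

end AdS

end

noncomputable section

namespace AdS

/-! ### The ambient bilinear form -/

/-! The ten-dimensional space `so32` is isomorphic to the space of real symmetric `4 × 4` matrices,
that is, to quadratic forms on Majorana spinors `v ∈ ℝ⁴`. Explicitly, `M` gives the form `v ↦
majoranaPairing v M` with matrix `majoranaMatrix M`, and the square `majoranaSquare v` of a spinor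
goes to `4 v vᵀ`. A positive semidefinite matrix is a Gram matrix, so every `M` with a nonnegative
form is a positive combination of four squares (`eq_sum_majoranaSquare`).

Squares belong to `𝒮`: the Killing spinor with an arbitrary value `s` at the origin can be written
down, and its Killing field is `√κ` times the quadratic bilinears of `s`
(`spinorSquare_mem_spinorSet`). Only this inclusion is needed, not a classification of Killing
spinors.

The form of an observer field is positive definite. By Frobenius, hypersurface orthogonality makes
the bivector of `M` simple, which gives the Plücker relation `A D = C × B`; timelikeness on the
plane `yⁱ = 0` gives `A > 0` and `|sB + tC|² < A² (s² + t²)`. A Majorana square obeys the same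
relation, with equality in the bound, so Cauchy–Schwarz and the Binet–Cauchy identity yield strict
positivity (`majoranaPairing_pos`). This puts `𝒪` in the convex hull of `𝒮`.

Positivity at a fixed `v ≠ 0` defines an open half-space, which therefore contains the convex hull
of `𝒪`. The explicit field is the square of a Dirac spinor, and its form is degenerate: it vanishes
at `v = (-1, 1, 1, 0)`, so the inclusion is proper.

The identification of Killing fields with `so32` comes from extending a field homogeneously to the
cone of timelike vectors of the flat ambient space. The extension is a Killing field there, hence
affine, hence linear by homogeneity. -/

theorem eta_apply (u v : Ambient) :
    eta u v = u (Sum.inl 0) * v (Sum.inl 0) + u (Sum.inl 1) * v (Sum.inl 1) +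
      u (Sum.inl 2) * v (Sum.inl 2) - u (Sum.inr 0) * v (Sum.inr 0) -
      u (Sum.inr 1) * v (Sum.inr 1) := by
  simp only [eta, Fin.sum_univ_three, Fin.sum_univ_two]
  ring

theorem eta_comm (u v : Ambient) : eta u v = eta v u := by
  simp only [eta_apply]
  ring

@[simp]
theorem eta_add_left (u u' v : Ambient) : eta (u + u') v = eta u v + eta u' v := by
  simp only [eta_apply, Pi.add_apply]
  ring

@[simp]
theorem eta_add_right (u v v' : Ambient) : eta u (v + v') = eta u v + eta u v' := by
  simp only [eta_apply, Pi.add_apply]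
  ring

@[simp]
theorem eta_smul_left (c : ℝ) (u v : Ambient) : eta (c • u) v = c * eta u v := by
  simp only [eta_apply, Pi.smul_apply, smul_eq_mul]
  ring

@[simp]
theorem eta_smul_right (c : ℝ) (u v : Ambient) : eta u (c • v) = c * eta u v := by
  simp only [eta_apply, Pi.smul_apply, smul_eq_mul]
  ring

/-- The form `eta` as a continuous bilinear map. -/
def etaCLM : Ambient →L[ℝ] Ambient →L[ℝ] ℝ :=
  LinearMap.toContinuousLinearMap
    ((LinearMap.toContinuousLinearMap (𝕜 := ℝ) (E := Ambient) (F' := ℝ)).toLinearMap ∘ₗ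
      LinearMap.mk₂ ℝ eta eta_add_left eta_smul_left eta_add_right eta_smul_right)

@[simp]
theorem etaCLM_apply (u v : Ambient) : etaCLM u v = eta u v := rfl

theorem eq_zero_of_eta_eq_zero {u : Ambient} (h : ∀ v, eta u v = 0) : u = 0 := by
  ext i
  have := h (Pi.single i 1)
  rcases i with i | i <;> fin_cases i <;> simpa [eta_apply] using this

section Derivatives

variable {E : Type*} [NormedAddCommGroup E] [NormedSpace ℝ E] {f g : E → Ambient} {z : E}

theorem differentiableAt_eta (hf : DifferentiableAt ℝ f z) (hg : DifferentiableAt ℝ g z) :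
    DifferentiableAt ℝ (fun w => eta (f w) (g w)) z :=
  (etaCLM.hasFDerivAt_of_bilinear hf.hasFDerivAt hg.hasFDerivAt).differentiableAt

theorem fderiv_eta (hf : DifferentiableAt ℝ f z) (hg : DifferentiableAt ℝ g z) (X : E) :
    fderiv ℝ (fun w => eta (f w) (g w)) z X =
      eta (f z) (fderiv ℝ g z X) + eta (fderiv ℝ f z X) (g z) := by
  have h := (etaCLM.hasFDerivAt_of_bilinear hf.hasFDerivAt hg.hasFDerivAt).fderiv
  simp only [etaCLM_apply] at h
  rw [h]
  simp

theorem contDiffOn_eta {n : ℕ∞} {s : Set E} (hf : ContDiffOn ℝ n f s) (hg : ContDiffOn ℝ n g s) :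
    ContDiffOn ℝ n (fun w => eta (f w) (g w)) s :=
  (etaCLM.contDiff.comp_contDiffOn hf).clm_apply hg

end Derivatives

/-! ### The cone of timelike vectors -/

/-- The open cone of timelike vectors, foliated by the multiples of the hyperboloid. -/
def cone : Set Ambient := {z | eta z z < 0}

/-- The factor by which `z` exceeds a point of the hyperboloid. -/
def radius (κ : ℝ) (z : Ambient) : ℝ := √(-κ * eta z z)

/-- The radial projection of the cone to the hyperboloid. -/
def radialProj (κ : ℝ) (z : Ambient) : Ambient := (radius κ z)⁻¹ • z

theorem continuous_eta_self : Continuous fun z : Ambient => eta z z := by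
  simp only [eta_apply]
  fun_prop

theorem isOpen_cone : IsOpen cone := isOpen_lt continuous_eta_self continuous_const

variable {κ : ℝ}

theorem mem_spacetime {y : Ambient} : y ∈ Spacetime κ ↔ eta y y = -1 / κ := Iff.rfl

theorem spacetime_subset_cone (hκ : 0 < κ) : Spacetime κ ⊆ cone := fun y hy => by
  rw [mem_spacetime] at hy
  change eta y y < 0
  rw [hy]
  exact div_neg_of_neg_of_pos (by norm_num) hκ

theorem radius_pos (hκ : 0 < κ) {z : Ambient} (hz : z ∈ cone) : 0 < radius κ z := by
  have : eta z z < 0 := hz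
  exact Real.sqrt_pos.2 (by nlinarith)

theorem radius_sq (hκ : 0 < κ) {z : Ambient} (hz : z ∈ cone) :
    radius κ z ^ 2 = -κ * eta z z := by
  have : eta z z < 0 := hz
  exact Real.sq_sqrt (by nlinarith)

theorem radius_smul_radialProj (hκ : 0 < κ) {z : Ambient} (hz : z ∈ cone) :
    radius κ z • radialProj κ z = z :=
  smul_inv_smul₀ (radius_pos hκ hz).ne' z

theorem radialProj_mem (hκ : 0 < κ) {z : Ambient} (hz : z ∈ cone) :
    radialProj κ z ∈ Spacetime κ := by
  have h := radius_sq hκ hz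
  have h0 := (radius_pos hκ hz).ne'
  rw [mem_spacetime, radialProj, eta_smul_left, eta_smul_right]
  field_simp
  linarith

theorem radius_eq_one (hκ : 0 < κ) {y : Ambient} (hy : y ∈ Spacetime κ) : radius κ y = 1 := by
  rw [radius, mem_spacetime.1 hy, Real.sqrt_eq_one]
  field_simp

theorem radialProj_eq_self (hκ : 0 < κ) {y : Ambient} (hy : y ∈ Spacetime κ) :
    radialProj κ y = y := by
  rw [radialProj, radius_eq_one hκ hy, inv_one, one_smul]

theorem radius_smul {c : ℝ} (hc : 0 < c) (z : Ambient) : radius κ (c • z) = c * radius κ z := by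
  rw [radius, eta_smul_left, eta_smul_right,
    show -κ * (c * (c * eta z z)) = c ^ 2 * (-κ * eta z z) by ring,
    Real.sqrt_mul (sq_nonneg c), Real.sqrt_sq hc.le, radius]

theorem radialProj_smul {c : ℝ} (hc : 0 < c) (z : Ambient) :
    radialProj κ (c • z) = radialProj κ z := by
  rw [radialProj, radius_smul hc, smul_smul, mul_inv_rev, mul_assoc, inv_mul_cancel₀ hc.ne',
    mul_one, radialProj]

theorem smul_mem_cone {c : ℝ} (hc : c ≠ 0) {z : Ambient} (hz : z ∈ cone) : c • z ∈ cone := by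
  have h : eta z z < 0 := hz
  change eta (c • z) (c • z) < 0
  rw [eta_smul_left, eta_smul_right]
  have : 0 < c * c := mul_self_pos.2 hc
  nlinarith

theorem contDiffOn_radius (hκ : 0 < κ) : ContDiffOn ℝ ∞ (radius κ) cone := by
  refine ContDiffOn.sqrt (contDiffOn_const.mul (contDiffOn_eta contDiffOn_id contDiffOn_id)) ?_
  intro z hz
  have : eta z z < 0 := hz
  have : 0 < -κ * eta z z := by nlinarith
  exact this.ne'

theorem contDiffOn_radialProj (hκ : 0 < κ) : ContDiffOn ℝ ∞ (radialProj κ) cone :=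
  ((contDiffOn_radius hκ).inv fun _ hz => (radius_pos hκ hz).ne').smul contDiffOn_id

theorem differentiableAt_radius (hκ : 0 < κ) {z : Ambient} (hz : z ∈ cone) :
    DifferentiableAt ℝ (radius κ) z :=
  ((contDiffOn_radius hκ).contDiffAt (isOpen_cone.mem_nhds hz)).differentiableAt (by simp)

theorem differentiableAt_radialProj (hκ : 0 < κ) {z : Ambient} (hz : z ∈ cone) :
    DifferentiableAt ℝ (radialProj κ) z :=
  ((contDiffOn_radialProj hκ).contDiffAt (isOpen_cone.mem_nhds hz)).differentiableAt (by simp)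

theorem isTangent_fderiv_radialProj (hκ : 0 < κ) {z : Ambient} (hz : z ∈ cone) (X : Ambient) :
    IsTangent (radialProj κ z) (fderiv ℝ (radialProj κ) z X) := by
  have hd := differentiableAt_radialProj hκ hz
  have h := fderiv_eta hd hd X
  have hc : (fun w => eta (radialProj κ w) (radialProj κ w)) =ᶠ[nhds z] fun _ => -1 / κ := by
    filter_upwards [isOpen_cone.mem_nhds hz] with w hw using radialProj_mem hκ hw
  rw [hc.fderiv_eq, fderiv_fun_const, eta_comm (fderiv ℝ _ z X)] at h
  simp only [Pi.zero_apply, zero_apply] at h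
  change eta _ _ = 0
  linarith

/-- This is the Leibniz rule for `z = radius κ z • radialProj κ z`. It splits `X` into a part
tangent to the hyperboloid and a radial part. -/
theorem radial_decomposition (hκ : 0 < κ) {z : Ambient} (hz : z ∈ cone) (X : Ambient) :
    X = radius κ z • fderiv ℝ (radialProj κ) z X +
      fderiv ℝ (radius κ) z X • radialProj κ z := by
  have h := fderiv_fun_smul (differentiableAt_radius hκ hz) (differentiableAt_radialProj hκ hz)
  have hc : (fun w => radius κ w • radialProj κ w) =ᶠ[nhds z] fun w => w := by
    filter_upwards [isOpen_cone.mem_nhds hz] with w hw using radius_smul_radialProj hκ hw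
  rw [hc.fderiv_eq, fderiv_fun_id] at h
  simpa using congrArg (fun L : Ambient →L[ℝ] Ambient => L X) h

/-! ### The static chart -/

theorem sum_sq_nonneg (x : Fin 3 → ℝ) : 0 ≤ ∑ i, x i ^ 2 :=
  Finset.sum_nonneg fun _ _ => sq_nonneg _

theorem lapse_sq (hκ : 0 < κ) (p : Static) : lapse κ p ^ 2 = 1 + κ * ∑ i, p.2 i ^ 2 :=
  Real.sq_sqrt (by have := sum_sq_nonneg p.2; positivity)

theorem one_add_pos (hκ : 0 < κ) (p : Static) : 0 < 1 + κ * ∑ i, p.2 i ^ 2 := by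
  have := sum_sq_nonneg p.2
  positivity

theorem lapse_pos (hκ : 0 < κ) (p : Static) : 0 < lapse κ p :=
  Real.sqrt_pos.2 (one_add_pos hκ p)

theorem contDiff_lapse (hκ : 0 < κ) : ContDiff ℝ ∞ (lapse κ) := by
  unfold lapse
  refine ContDiff.sqrt (by fun_prop) fun p => (one_add_pos hκ p).ne'

/-- Polar coordinates for `ζ = y⁰ + i y⁴`: the equation of the hyperboloid forces `|ζ| = lapse /
√κ`, and the argument of `ζ` is `√κ t`. -/
theorem exists_chart_eq (hκ : 0 < κ) {y : Ambient} (hy : y ∈ Spacetime κ) :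
    ∃ p, chart κ p = y := by
  have hs : 0 < √κ := Real.sqrt_pos.2 hκ
  set ζ : ℂ := ⟨y (Sum.inr 0), y (Sum.inr 1)⟩ with hζ
  let p : Static := (Complex.arg ζ / √κ, fun i => y (Sum.inl i))
  refine ⟨p, ?_⟩
  have hL : lapse κ p / √κ = ‖ζ‖ := by
    rw [← sq_eq_sq₀ (div_nonneg (lapse_pos hκ p).le hs.le) (norm_nonneg ζ), div_pow,
      lapse_sq hκ, Real.sq_sqrt hκ.le, Complex.sq_norm, Complex.normSq_apply]
    rw [mem_spacetime, eta_apply] at hy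
    simp only [p, hζ, Fin.sum_univ_three]
    field_simp at hy ⊢
    linarith
  have ht : √κ * p.1 = Complex.arg ζ := mul_div_cancel₀ _ hs.ne'
  ext i
  rcases i with i | i
  · rfl
  · fin_cases i
    · simp [chart, hL, ht, hζ]
    · simp [chart, hL, ht, hζ]

theorem isPreconnected_cone : IsPreconnected cone := by
  have h1 : (0 : ℝ) < 1 := one_pos
  have : cone = Set.range fun q : ℝ × Static => Real.exp q.1 • chart 1 q.2 := by
    ext z
    constructor
    · intro hz
      obtain ⟨p, hp⟩ := exists_chart_eq h1 (radialProj_mem h1 hz)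
      refine ⟨(Real.log (radius 1 z), p), ?_⟩
      change Real.exp (Real.log _) • chart 1 p = z
      rw [Real.exp_log (radius_pos h1 hz), hp, radius_smul_radialProj h1 hz]
    · rintro ⟨q, rfl⟩
      exact smul_mem_cone (Real.exp_pos _).ne' (spacetime_subset_cone h1 (chart_mem h1 _))
  rw [this]
  refine isPreconnected_range (Continuous.smul (Real.continuous_exp.comp continuous_fst)
    (continuous_pi fun i => ?_))
  have hl : Continuous fun q : ℝ × Static => lapse 1 q.2 :=
    (contDiff_lapse h1).continuous.comp continuous_snd
  rcases i with i | i
  · simp only [chart, Sum.elim_inl]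
    fun_prop
  · fin_cases i <;> simp [chart] <;> fun_prop

/-! ### Killing fields are linear -/

/-- A trilinear expression which is symmetric in the first two arguments and antisymmetric in the
last two vanishes. -/
theorem eq_zero_of_symm_of_antisymm {α : Type*} (t : α → α → α → ℝ)
    (hs : ∀ x y z, t x y z = t y x z) (ha : ∀ x y z, t x y z = -t x z y) (x y z : α) :
    t x y z = 0 := by
  have h1 := ha x y z
  have h2 := hs x z y
  have h3 := ha z x y
  have h4 := hs z y x
  have h5 := ha y z x
  have h6 := hs y x z
  linarith

/-- The derivative of a Killing field of the flat pseudo-Euclidean space on a connected open set is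
constant. -/
theorem fderiv_eq_of_flat_killing {U : Set Ambient} (hU : IsOpen U) (hU' : IsPreconnected U)
    {W : Ambient → Ambient} (hW : ContDiffOn ℝ ∞ W U)
    (hK : ∀ z ∈ U, ∀ X Y, eta (fderiv ℝ W z X) Y + eta X (fderiv ℝ W z Y) = 0)
    {z w : Ambient} (hz : z ∈ U) (hw : w ∈ U) : fderiv ℝ W z = fderiv ℝ W w := by
  have hcd : ∀ z ∈ U, ContDiffAt ℝ ∞ W z := fun z hz => hW.contDiffAt (hU.mem_nhds hz)
  have hdd : ∀ z ∈ U, DifferentiableAt ℝ (fderiv ℝ W) z := fun z hz =>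
    ((hcd z hz).fderiv_right (m := 1) (by norm_cast)).differentiableAt (by simp)
  refine hU.is_const_of_fderiv_eq_zero hU' (fun z hz => (hdd z hz).differentiableWithinAt)
    (fun z hz => ?_) hz hw
  have hsymm : IsSymmSndFDerivAt ℝ W z := (hcd z hz).isSymmSndFDerivAt (by simp; norm_cast)
  have hap : ∀ X : Ambient, DifferentiableAt ℝ (fun w => fderiv ℝ W w X) z := fun X =>
    (hdd z hz).clm_apply (differentiableAt_const X)
  have hfd : ∀ X Z : Ambient, fderiv ℝ (fun w => fderiv ℝ W w X) z Z =
      fderiv ℝ (fderiv ℝ W) z Z X := fun X Z => by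
    rw [fderiv_clm_apply (hdd z hz) (differentiableAt_const X)]
    simp
  -- `⟨D²W(Z, X), Y⟩` is symmetric in `Z, X` as a second derivative, and the differentiated Killing
  -- equation makes it antisymmetric in `X, Y`.
  have key : ∀ Z X Y, eta (fderiv ℝ (fderiv ℝ W) z Z X) Y = 0 := by
    refine eq_zero_of_symm_of_antisymm _ (fun Z X Y => ?_) (fun Z X Y => ?_)
    · rw [hsymm.eq Z X]
    · have hc : (fun w => eta (fderiv ℝ W w X) Y + eta (fderiv ℝ W w Y) X)
          =ᶠ[nhds z] fun _ => 0 := by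
        filter_upwards [hU.mem_nhds hz] with w hw
        rw [eta_comm (fderiv ℝ W w Y)]
        exact hK w hw X Y
      have h := congrArg (fun L : Ambient →L[ℝ] ℝ => L Z) hc.fderiv_eq
      have hcX : DifferentiableAt ℝ (fun _ : Ambient => X) z := differentiableAt_const X
      have hcY : DifferentiableAt ℝ (fun _ : Ambient => Y) z := differentiableAt_const Y
      rw [fderiv_fun_add (differentiableAt_eta (hap X) hcY)
        (differentiableAt_eta (hap Y) hcX)] at h
      simp only [add_apply, fderiv_eta (hap X) hcY, fderiv_eta (hap Y) hcX, hfd,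
        fderiv_fun_const, Pi.zero_apply, zero_apply] at h
      have h0 : ∀ u, eta u 0 = 0 := fun u => (etaCLM u).map_zero
      rw [h0, h0] at h
      linarith
  ext1 Z
  ext1 X
  exact eq_zero_of_eta_eq_zero (key Z X)

/-- The homogeneous extension of degree one of a vector field on the hyperboloid. -/
def homogeneousExtension (κ : ℝ) (W : Ambient → Ambient) (z : Ambient) : Ambient :=
  radius κ z • W (radialProj κ z)

theorem contDiffOn_homogeneousExtension (hκ : 0 < κ) {W : Ambient → Ambient}
    (hW : ContDiff ℝ ∞ W) : ContDiffOn ℝ ∞ (homogeneousExtension κ W) cone :=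
  (contDiffOn_radius hκ).smul (hW.comp_contDiffOn (contDiffOn_radialProj hκ))

/-- Split `X` and `Y` into tangential and radial parts. The purely tangential terms cancel by the
Killing equation on the hyperboloid, the mixed terms by the derivative of `⟨W, y⟩ = 0`, and the
radial terms by `⟨W, y⟩ = 0` itself. -/
theorem homogeneousExtension_killing (hκ : 0 < κ) {W : Ambient → Ambient} (hW : ContDiff ℝ ∞ W)
    (hT : ∀ y ∈ Spacetime κ, IsTangent y (W y))
    (hK : ∀ y ∈ Spacetime κ, ∀ X Y, IsTangent y X → IsTangent y Y →
      eta (fderiv ℝ W y X) Y + eta X (fderiv ℝ W y Y) = 0)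
    {z : Ambient} (hz : z ∈ cone) (X Y : Ambient) :
    eta (fderiv ℝ (homogeneousExtension κ W) z X) Y +
      eta X (fderiv ℝ (homogeneousExtension κ W) z Y) = 0 := by
  have hWd : Differentiable ℝ W := hW.differentiable (by simp)
  have hd := differentiableAt_radialProj hκ hz
  have hWp : DifferentiableAt ℝ (fun w => W (radialProj κ w)) z := (hWd _).comp z hd
  have hfW : ∀ X, fderiv ℝ (fun w => W (radialProj κ w)) z X =
      fderiv ℝ W (radialProj κ z) (fderiv ℝ (radialProj κ) z X) := fun X => by
    rw [fderiv_fun_comp z (hWd _) hd]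
    rfl
  have hE : ∀ X, fderiv ℝ (homogeneousExtension κ W) z X =
      radius κ z • fderiv ℝ W (radialProj κ z) (fderiv ℝ (radialProj κ) z X) +
        fderiv ℝ (radius κ) z X • W (radialProj κ z) := fun X => by
    have h := fderiv_fun_smul (differentiableAt_radius hκ hz) hWp
    have := congrArg (fun L : Ambient →L[ℝ] Ambient => L X) h
    simp only [add_apply, smul_apply, ContinuousLinearMap.smulRight_apply, hfW] at this
    exact this
  have hmem := radialProj_mem hκ hz
  have hX := radial_decomposition hκ hz X
  have hY := radial_decomposition hκ hz Y
  have hX' := isTangent_fderiv_radialProj hκ hz X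
  have hY' := isTangent_fderiv_radialProj hκ hz Y
  have hTW : ∀ X, eta (W (radialProj κ z)) (fderiv ℝ (radialProj κ) z X) +
      eta (fderiv ℝ W (radialProj κ z) (fderiv ℝ (radialProj κ) z X)) (radialProj κ z) = 0 := by
    intro X
    have h := fderiv_eta hWp hd X
    have hc : (fun w => eta (W (radialProj κ w)) (radialProj κ w)) =ᶠ[nhds z] fun _ => 0 := by
      filter_upwards [isOpen_cone.mem_nhds hz] with w hw
      rw [eta_comm]
      exact hT _ (radialProj_mem hκ hw)
    rw [hc.fderiv_eq, hfW] at h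
    simpa using h.symm
  have hTX := hTW X
  have hTY := hTW Y
  have hKy := hK _ hmem _ _ hX' hY'
  have hWy : eta (radialProj κ z) (W (radialProj κ z)) = 0 := hT _ hmem
  rw [hE, hE]
  generalize fderiv ℝ (radialProj κ) z X = X' at *
  generalize fderiv ℝ (radialProj κ) z Y = Y' at *
  generalize fderiv ℝ (radius κ) z X = a at *
  generalize fderiv ℝ (radius κ) z Y = b at *
  rw [hX, hY]
  generalize radius κ z = ρ at *
  generalize radialProj κ z = y at *
  have hWy' : eta (W y) y = 0 := by rw [eta_comm]; exact hWy
  rw [eta_comm (fderiv ℝ W y Y') y] at hTY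
  simp only [eta_add_left, eta_add_right, eta_smul_left, eta_smul_right, hWy, hWy']
  rw [eta_comm X' (W y)]
  linear_combination ρ ^ 2 * hKy + ρ * b * hTX + ρ * a * hTY

/-- A Killing field of the hyperboloid is the restriction of a linear vector field. -/
theorem exists_linear_of_isKilling (hκ : 0 < κ) {V : Spacetime κ → Ambient} (hV : IsKilling κ V) :
    ∃ L : Ambient →L[ℝ] Ambient, (∀ X Y, eta (L X) Y + eta X (L Y) = 0) ∧
      ∀ y : Spacetime κ, V y = L y := by
  obtain ⟨hT, W, hW, hWV, hK⟩ := hV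
  have hT' : ∀ y ∈ Spacetime κ, IsTangent y (W y) := fun y hy => by
    rw [hWV ⟨y, hy⟩]
    exact hT ⟨y, hy⟩
  have hK' := fun z hz => homogeneousExtension_killing hκ hW hT' (fun y hy => hK ⟨y, hy⟩)
    (z := z) hz
  have hsm := contDiffOn_homogeneousExtension hκ hW
  have hdiff : ∀ z ∈ cone, DifferentiableAt ℝ (homogeneousExtension κ W) z := fun z hz =>
    (hsm.contDiffAt (isOpen_cone.mem_nhds hz)).differentiableAt (by simp)
  rcases (Spacetime κ).eq_empty_or_nonempty with he | ⟨y₀, hy₀⟩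
  · exact ⟨0, fun X Y => by simp [eta_apply], fun y => by simpa [he] using y.2⟩
  have hc₀ := spacetime_subset_cone hκ hy₀
  set L := fderiv ℝ (homogeneousExtension κ W) y₀
  refine ⟨L, hK' y₀ hc₀, fun y => ?_⟩
  have hy := spacetime_subset_cone hκ y.2
  have h2 : (2 : ℝ) • (y : Ambient) ∈ cone := smul_mem_cone two_ne_zero hy
  -- The extension minus `L` is constant on the cone and homogeneous of degree one. Comparing its
  -- values at `y` and `2y` shows that the constant is zero.
  have hconst : homogeneousExtension κ W y - L y =
      homogeneousExtension κ W ((2 : ℝ) • (y : Ambient)) - L ((2 : ℝ) • (y : Ambient)) := by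
    refine isOpen_cone.is_const_of_fderiv_eq_zero (f := fun z => homogeneousExtension κ W z - L z)
      isPreconnected_cone
      (fun z hz => ((hdiff z hz).sub L.differentiableAt).differentiableWithinAt) (fun z hz => ?_)
      hy h2
    have := fderiv_eq_of_flat_killing isOpen_cone isPreconnected_cone hsm hK' hz hc₀
    rw [fderiv_fun_sub (hdiff z hz) L.differentiableAt, L.fderiv, this, sub_self]
    rfl
  have hhom : homogeneousExtension κ W ((2 : ℝ) • (y : Ambient)) =
      (2 : ℝ) • homogeneousExtension κ W y := by
    simp only [homogeneousExtension, radius_smul two_pos, radialProj_smul two_pos, smul_smul]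
  have hval : homogeneousExtension κ W y = V y := by
    rw [homogeneousExtension, radius_eq_one hκ y.2, radialProj_eq_self hκ y.2, one_smul, hWV]
  rw [hhom, map_smul, ← smul_sub, two_smul, left_eq_add, sub_eq_zero] at hconst
  rw [← hval, hconst]

/-! ### The correspondence with `so(3,2)` -/

theorem eta_eq_dotProduct (u v : Ambient) :
    eta u v = u ⬝ᵥ (LieAlgebra.Orthogonal.indefiniteDiagonal (Fin 3) (Fin 2) ℝ *ᵥ v) := by
  simp [eta_apply, LieAlgebra.Orthogonal.indefiniteDiagonal, Matrix.mulVec_diagonal, dotProduct,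
    Fin.sum_univ_three, Fin.sum_univ_two]
  ring

theorem mem_so32_iff {M : Matrix (Fin 3 ⊕ Fin 2) (Fin 3 ⊕ Fin 2) ℝ} :
    M ∈ so32 ↔ ∀ X Y, eta (M *ᵥ X) Y + eta X (M *ᵥ Y) = 0 := by
  rw [mem_skewAdjointMatricesSubmodule, Matrix.IsSkewAdjoint, Matrix.IsAdjointPair]
  generalize hJ : LieAlgebra.Orthogonal.indefiniteDiagonal (Fin 3) (Fin 2) ℝ = J
  have h : ∀ X Y, eta (M *ᵥ X) Y + eta X (M *ᵥ Y) = X ⬝ᵥ ((Mᵀ * J - J * -M) *ᵥ Y) := by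
    intro X Y
    rw [eta_eq_dotProduct, eta_eq_dotProduct, hJ, Matrix.sub_mulVec, dotProduct_sub,
      ← Matrix.mulVec_mulVec, ← Matrix.mulVec_mulVec, Matrix.neg_mulVec, Matrix.mulVec_neg,
      dotProduct_neg, sub_neg_eq_add, Matrix.dotProduct_mulVec X Mᵀ, Matrix.vecMul_transpose]
  simp only [h]
  rw [← sub_eq_zero]
  constructor
  · intro h0 X Y
    rw [h0, Matrix.zero_mulVec, dotProduct_zero]
  · intro h0
    ext i j
    simpa using h0 (Pi.single i 1) (Pi.single j 1)

theorem eta_mulVec (M : so32) (X Y : Ambient) : eta (M.1 *ᵥ X) Y = -eta X (M.1 *ᵥ Y) := by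
  have := mem_so32_iff.1 M.2 X Y
  linarith

theorem eta_mulVec_self (M : so32) (X : Ambient) : eta X (M.1 *ᵥ X) = 0 := by
  have := eta_mulVec M X X
  rw [eta_comm] at this
  linarith

theorem field_isKilling (κ : ℝ) (M : so32) : IsKilling κ (field κ M) := by
  refine ⟨fun y => eta_mulVec_self M y, fun z => M.1.mulVecLin.toContinuousLinearMap z,
    ContinuousLinearMap.contDiff _, fun y => rfl, fun y X Y _ _ => ?_⟩
  rw [ContinuousLinearMap.fderiv]
  exact mem_so32_iff.1 M.2 X Y

/-- A continuous linear map is determined by its restriction to the hyperboloid. -/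
theorem linearMap_eq_of_eqOn_spacetime (hκ : 0 < κ) {F : Type*} [NormedAddCommGroup F]
    [NormedSpace ℝ F] {L L' : Ambient →L[ℝ] F} (h : ∀ y ∈ Spacetime κ, L y = L' y) : L = L' := by
  have hc : Set.EqOn L L' cone := fun z hz => by
    rw [← radius_smul_radialProj hκ hz, map_smul, map_smul, h _ (radialProj_mem hκ hz)]
  have h0 : (Pi.single (Sum.inr 0) 1 : Ambient) ∈ cone := by
    change eta _ _ < 0
    simp [eta_apply]
  -- Linear maps that agree on a nonempty open set have the same derivative there, and each is its
  -- own derivative.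
  have := (hc.eventuallyEq_of_mem (isOpen_cone.mem_nhds h0)).fderiv_eq (𝕜 := ℝ)
  rwa [L.fderiv, L'.fderiv] at this

theorem bijOn_field (hκ : 0 < κ) : Set.BijOn (field κ) Set.univ {V | IsKilling κ V} := by
  refine ⟨fun M _ => field_isKilling κ M, fun M _ N _ h => ?_, fun V hV => ?_⟩
  · have : M.1.mulVecLin.toContinuousLinearMap = N.1.mulVecLin.toContinuousLinearMap :=
      linearMap_eq_of_eqOn_spacetime hκ fun y hy => congrFun h ⟨y, hy⟩
    apply Subtype.ext
    apply Matrix.mulVec_injective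
    funext z
    exact congrArg (fun L : Ambient →L[ℝ] Ambient => L z) this
  · obtain ⟨L, hL, hLV⟩ := exists_linear_of_isKilling hκ hV
    have hm : ∀ X, L.toLinearMap.toMatrix' *ᵥ X = L X := fun X => by
      rw [← Matrix.toLin'_apply, Matrix.toLin'_toMatrix']
      rfl
    refine ⟨⟨L.toLinearMap.toMatrix', mem_so32_iff.2 fun X Y => ?_⟩, trivial, ?_⟩
    · rw [hm, hm]
      exact hL X Y
    · funext y
      rw [hLV]
      exact hm y

/-! ### Coordinates on `so(3,2)` -/

/-- The coordinate `A` on `so(3,2)`. -/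
def coordA : so32 →ₗ[ℝ] ℝ where
  toFun M := M.1 (Sum.inr 1) (Sum.inr 0)
  map_add' _ _ := rfl
  map_smul' _ _ := rfl

/-- The coordinates `B` on `so(3,2)`. -/
def coordB : so32 →ₗ[ℝ] (Fin 3 → ℝ) where
  toFun M := fun i => M.1 (Sum.inl i) (Sum.inr 0)
  map_add' _ _ := rfl
  map_smul' _ _ := rfl

/-- The coordinates `C` on `so(3,2)`. -/
def coordC : so32 →ₗ[ℝ] (Fin 3 → ℝ) where
  toFun M := fun i => M.1 (Sum.inl i) (Sum.inr 1)
  map_add' _ _ := rfl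
  map_smul' _ _ := rfl

/-- The coordinates `D` on `so(3,2)`. -/
def coordD : so32 →ₗ[ℝ] (Fin 3 → ℝ) where
  toFun M := ![M.1 (Sum.inl 2) (Sum.inl 1), M.1 (Sum.inl 0) (Sum.inl 2),
    M.1 (Sum.inl 1) (Sum.inl 0)]
  map_add' _ _ := by ext i; fin_cases i <;> rfl
  map_smul' _ _ := by ext i; fin_cases i <;> rfl

theorem coordA_apply (M : so32) : coordA M = M.1 (Sum.inr 1) (Sum.inr 0) := rfl

theorem coordB_apply (M : so32) (i : Fin 3) : coordB M i = M.1 (Sum.inl i) (Sum.inr 0) := rfl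

theorem coordC_apply (M : so32) (i : Fin 3) : coordC M i = M.1 (Sum.inl i) (Sum.inr 1) := rfl

theorem coordD_apply (M : so32) : coordD M = ![M.1 (Sum.inl 2) (Sum.inl 1),
    M.1 (Sum.inl 0) (Sum.inl 2), M.1 (Sum.inl 1) (Sum.inl 0)] := rfl

theorem coordA_coord (A : ℝ) (B C D : Fin 3 → ℝ) : coordA (coord A B C D) = A := by
  simp [coordA_apply, coord, coordMatrix, coordVector]

theorem coordB_coord (A : ℝ) (B C D : Fin 3 → ℝ) : coordB (coord A B C D) = B := by
  ext i
  fin_cases i <;> simp [coordB_apply, coord, coordMatrix, coordVector, crossProduct]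

theorem coordC_coord (A : ℝ) (B C D : Fin 3 → ℝ) : coordC (coord A B C D) = C := by
  ext i
  fin_cases i <;> simp [coordC_apply, coord, coordMatrix, coordVector, crossProduct]

theorem coordD_coord (A : ℝ) (B C D : Fin 3 → ℝ) : coordD (coord A B C D) = D := by
  ext i
  fin_cases i <;> simp [coordD_apply, coord, coordMatrix, coordVector, crossProduct]

theorem so32_apply_eq (M : so32) (i j : Fin 3 ⊕ Fin 2) :
    eta (M.1.col j) (Pi.single i 1) = -eta (Pi.single j 1) (M.1.col i) := by
  have := eta_mulVec M (Pi.single j 1) (Pi.single i 1)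
  rwa [Matrix.mulVec_single_one, Matrix.mulVec_single_one] at this

theorem coord_eq_self (M : so32) : coord (coordA M) (coordB M) (coordC M) (coordD M) = M := by
  have h := so32_apply_eq M
  apply Subtype.ext
  ext i j
  have hij := h i j
  rcases i with i | i <;> rcases j with j | j <;> fin_cases i <;> fin_cases j <;>
    simp [coordA_apply, coordB_apply, coordC_apply, coordD_apply, coord,
      coordMatrix, coordVector, crossProduct,
      eta_apply, Fin.sum_univ_three, Pi.single_apply] at hij ⊢ <;> linarith

theorem so32_ext {M N : so32} (hA : coordA M = coordA N) (hB : coordB M = coordB N)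
    (hC : coordC M = coordC N) (hD : coordD M = coordD N) : M = N := by
  rw [← coord_eq_self M, ← coord_eq_self N, hA, hB, hC, hD]

/-! ### Hypersurface orthogonal timelike fields are simple bivectors -/

/-- If the kernel of `dg` is contained in that of the one-form `α_z X = ⟨M z, X⟩` near `y` and
`α ≠ 0` at `y`, then the two-form `⟨M X, Y⟩`, which is half the exterior derivative of `α`, is
divisible by `α` at `y`. -/
theorem exists_factor_of_integrable (M : so32) {g : Ambient → ℝ} {y X₀ : Ambient}
    (hg : ContDiffAt ℝ ∞ g y) (hα : eta (M.1 *ᵥ y) X₀ ≠ 0)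
    (hker : ∀ᶠ z in nhds y, ∀ X, fderiv ℝ g z X = 0 → eta (M.1 *ᵥ z) X = 0) :
    ∃ p : Ambient → ℝ, ∀ X Y, eta (M.1 *ᵥ X) Y =
      p X * eta (M.1 *ᵥ y) Y - p Y * eta (M.1 *ᵥ y) X := by
  -- The vector `dg(X₀) X - dg(X) X₀` lies in the kernel of `dg`, hence in that of `α`: the two
  -- forms are proportional.
  have hprop : ∀ᶠ z in nhds y, ∀ X, eta (M.1 *ᵥ z) X * fderiv ℝ g z X₀ =
      eta (M.1 *ᵥ z) X₀ * fderiv ℝ g z X := by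
    filter_upwards [hker] with z hz X
    have h := hz (fderiv ℝ g z X₀ • X + (-fderiv ℝ g z X) • X₀) (by simp; ring)
    rw [eta_add_right, eta_smul_right, eta_smul_right] at h
    linarith
  have hdd : DifferentiableAt ℝ (fderiv ℝ g) y :=
    (hg.fderiv_right (m := 1) (by norm_cast)).differentiableAt (by simp)
  have hsymm : IsSymmSndFDerivAt ℝ g y := hg.isSymmSndFDerivAt (by simp; norm_cast)
  have hd1 : ∀ X : Ambient, DifferentiableAt ℝ (fun w => fderiv ℝ g w X) y := fun X =>
    hdd.clm_apply (differentiableAt_const X)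
  have hf1 : ∀ X Z : Ambient, fderiv ℝ (fun w => fderiv ℝ g w X) y Z =
      fderiv ℝ (fderiv ℝ g) y Z X := fun X Z => by
    rw [fderiv_clm_apply hdd (differentiableAt_const X)]
    simp
  have hdM : DifferentiableAt ℝ (fun w : Ambient => M.1 *ᵥ w) y :=
    M.1.mulVecLin.toContinuousLinearMap.differentiableAt
  have hfM : ∀ Z, fderiv ℝ (fun w : Ambient => M.1 *ᵥ w) y Z = M.1 *ᵥ Z := fun Z =>
    congrArg (fun L : Ambient →L[ℝ] Ambient => L Z)
      (M.1.mulVecLin.toContinuousLinearMap.fderiv (x := y))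
  have hd2 : ∀ X : Ambient, DifferentiableAt ℝ (fun w : Ambient => eta (M.1 *ᵥ w) X) y := fun X =>
    differentiableAt_eta hdM (differentiableAt_const X)
  have hf2 : ∀ X Z : Ambient, fderiv ℝ (fun w : Ambient => eta (M.1 *ᵥ w) X) y Z =
      eta (M.1 *ᵥ Z) X := fun X Z => by
    rw [fderiv_eta hdM (differentiableAt_const X), hfM, fderiv_fun_const]
    simp [eta_apply]
  have hder : ∀ X Z, eta (M.1 *ᵥ Z) X * fderiv ℝ g y X₀ +
      eta (M.1 *ᵥ y) X * fderiv ℝ (fderiv ℝ g) y Z X₀ =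
      eta (M.1 *ᵥ Z) X₀ * fderiv ℝ g y X +
      eta (M.1 *ᵥ y) X₀ * fderiv ℝ (fderiv ℝ g) y Z X := fun X Z => by
    have hc : (fun z => eta (M.1 *ᵥ z) X * fderiv ℝ g z X₀) =ᶠ[nhds y]
        fun z => eta (M.1 *ᵥ z) X₀ * fderiv ℝ g z X := by
      filter_upwards [hprop] with z hz using hz X
    have h := congrArg (fun L : Ambient →L[ℝ] ℝ => L Z) hc.fderiv_eq
    rw [fderiv_fun_mul (hd2 X) (hd1 X₀), fderiv_fun_mul (hd2 X₀) (hd1 X)] at h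
    simp only [add_apply, smul_apply, smul_eq_mul, hf1, hf2] at h
    linarith
  have hk : fderiv ℝ g y X₀ ≠ 0 := fun h => hα (hker.self_of_nhds X₀ h)
  have hβ := hprop.self_of_nhds
  set k := fderiv ℝ g y X₀
  set a := eta (M.1 *ᵥ y) X₀
  -- Near `y`, `α = h dg` with `h = α(X₀) / dg(X₀)`, so `dα = d(log h) ∧ α`. The witness is `½ d(log
  -- h)` at `y`; the Hessian of `g` drops out on antisymmetrizing.
  refine ⟨fun Z => (eta (M.1 *ᵥ Z) X₀ * k / a - fderiv ℝ (fderiv ℝ g) y Z X₀) / (2 * k),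
    fun Z X => ?_⟩
  have h1 := hder X Z
  have h2 := hder Z X
  have hs : fderiv ℝ (fderiv ℝ g) y Z X = fderiv ℝ (fderiv ℝ g) y X Z := hsymm.eq Z X
  have ha : eta (M.1 *ᵥ X) Z = -eta (M.1 *ᵥ Z) X := by rw [eta_mulVec, eta_comm]
  have hX : fderiv ℝ g y X = eta (M.1 *ᵥ y) X * k / a := by
    rw [eq_div_iff hα, hβ X]
    ring
  have hZ : fderiv ℝ g y Z = eta (M.1 *ᵥ y) Z * k / a := by
    rw [eq_div_iff hα, hβ Z]
    ring
  rw [hX, hs] at h1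
  rw [hZ, ha] at h2
  field_simp at h1 h2 ⊢
  linarith

/-- The function `f` is controlled only along the hyperboloid, so it is replaced by `f ∘ radialProj
κ`, constant on rays. Since `⟨M z, z⟩ = 0`, the inclusion of kernels then holds in an ambient
neighbourhood, and `X₀ = M y` serves as the transversal vector. -/
theorem exists_factor_of_isHypersurfaceOrthogonal (hκ : 0 < κ) {M : so32}
    (h : IsHypersurfaceOrthogonal κ (field κ M)) (y : Spacetime κ)
    (hy : eta (field κ M y) (field κ M y) ≠ 0) :
    ∃ p q : Ambient → ℝ, ∀ X Y, eta (M.1 *ᵥ X) Y = p X * q Y - p Y * q X := by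
  obtain ⟨U, hU, hyU, f, hf, hfU⟩ := h y
  have hyc := spacetime_subset_cone hκ y.2
  have hyp := radialProj_eq_self hκ y.2
  have hN : ∀ᶠ z in nhds (y : Ambient), z ∈ cone ∧ radialProj κ z ∈ U := by
    refine Filter.Eventually.and (isOpen_cone.mem_nhds hyc) ?_
    refine (differentiableAt_radialProj hκ hyc).continuousAt.eventually_mem ?_
    rw [hyp]
    exact hU.mem_nhds hyU
  have hfc : ∀ z ∈ U, ContDiffAt ℝ ∞ f z := fun z hz => hf.contDiffAt (hU.mem_nhds hz)
  have hg : ContDiffAt ℝ ∞ (fun z => f (radialProj κ z)) y := by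
    have hfy : ContDiffAt ℝ ∞ f (radialProj κ y) := by
      rw [hyp]
      exact hfc _ hyU
    exact hfy.comp (y : Ambient)
      ((contDiffOn_radialProj hκ).contDiffAt (isOpen_cone.mem_nhds hyc))
  suffices hker : ∀ᶠ z in nhds (y : Ambient), ∀ X,
      fderiv ℝ (fun z => f (radialProj κ z)) z X = 0 → eta (M.1 *ᵥ z) X = 0 by
    obtain ⟨p, hp⟩ := exists_factor_of_integrable M hg hy hker
    exact ⟨p, _, hp⟩
  filter_upwards [hN] with z ⟨hzc, hzU⟩ X hX
  have hmem := radialProj_mem hκ hzc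
  rw [fderiv_fun_comp z ((hfc _ hzU).differentiableAt (by simp))
    (differentiableAt_radialProj hκ hzc)] at hX
  have h0 := (hfU ⟨_, hmem⟩ hzU).2 _ (isTangent_fderiv_radialProj hκ hzc X) hX
  have h0' : eta (M.1 *ᵥ radialProj κ z) (fderiv ℝ (radialProj κ) z X) = 0 := h0
  have h1 : eta (M.1 *ᵥ radialProj κ z) (radialProj κ z) = 0 := by
    rw [eta_comm]
    exact eta_mulVec_self M _
  have hz : M.1 *ᵥ z = radius κ z • (M.1 *ᵥ radialProj κ z) := by
    rw [← Matrix.mulVec_smul, radius_smul_radialProj hκ hzc]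
  rw [radial_decomposition hκ hzc X, hz]
  simp only [eta_add_right, eta_smul_left, eta_smul_right, h0', h1]
  ring

/-- The Plücker relation for a simple element of `so(3,2)`. -/
theorem coordA_smul_coordD_of_factor {M : so32} {p q : Ambient → ℝ}
    (h : ∀ X Y, eta (M.1 *ᵥ X) Y = p X * q Y - p Y * q X) :
    coordA M • coordD M = coordC M ⨯₃ coordB M := by
  have hc : ∀ i j, eta (M.1.col j) (Pi.single i 1) =
      p (Pi.single j 1) * q (Pi.single i 1) - p (Pi.single i 1) * q (Pi.single j 1) := by
    intro i j
    rw [← h, Matrix.mulVec_single_one]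
  have hl : ∀ i j, M.1 (Sum.inl i) j = p (Pi.single j 1) * q (Pi.single (Sum.inl i) 1) -
      p (Pi.single (Sum.inl i) 1) * q (Pi.single j 1) := by
    intro i j
    rw [← hc]
    fin_cases i <;> simp [eta_apply]
  have hr : M.1 (Sum.inr 1) (Sum.inr 0) =
      -(p (Pi.single (Sum.inr 0) 1) * q (Pi.single (Sum.inr 1) 1) -
      p (Pi.single (Sum.inr 1) 1) * q (Pi.single (Sum.inr 0) 1)) := by
    rw [← hc]
    simp [eta_apply]
  ext i
  fin_cases i <;> simp [coordA_apply, coordB_apply, coordC_apply, coordD_apply, crossProduct, hl, hr] <;> ring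

/-! ### Future timelike fields -/

/-- At a point with `yⁱ = 0` and `(y⁰, y⁴) = (s, t)` the field is `(sB + tC; -At, As)`, so the
bounds are timelikeness and time orientation there. Linearity carries them from the hyperboloid to
the whole plane. -/
theorem timelike_bounds (hκ : 0 < κ) {A : ℝ} {B C D : Fin 3 → ℝ}
    (h : IsFutureTimelike κ (field κ (coord A B C D))) :
    0 < A ∧ ∀ s t : ℝ, (s ≠ 0 ∨ t ≠ 0) →
      (s • B + t • C) ⬝ᵥ (s • B + t • C) < A ^ 2 * (s ^ 2 + t ^ 2) := by
  have hval : ∀ s t : ℝ, (s ≠ 0 ∨ t ≠ 0) →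
      eta (coordVector A B C D (Sum.elim 0 ![s, t])) (coordVector A B C D (Sum.elim 0 ![s, t])) < 0 ∧
      eta (coordVector A B C D (Sum.elim 0 ![s, t]))
        (coordVector 1 0 0 0 (Sum.elim 0 ![s, t])) < 0 := by
    intro s t hst
    have hc : (Sum.elim 0 ![s, t] : Ambient) ∈ cone := by
      change eta _ _ < 0
      rcases hst with h | h
      · have := mul_self_pos.2 h
        simp [eta_apply]
        nlinarith [mul_self_nonneg t]
      · have := mul_self_pos.2 h
        simp [eta_apply]
        nlinarith [mul_self_nonneg s]
    have hr := radius_pos hκ hc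
    have hh := h ⟨_, radialProj_mem hκ hc⟩
    rw [field_coord] at hh
    have hs : ∀ A B C D, coordVector A B C D (Sum.elim 0 ![s, t]) =
        radius κ (Sum.elim 0 ![s, t]) •
          coordVector A B C D (radialProj κ (Sum.elim 0 ![s, t])) := by
      intro A B C D
      conv_lhs => rw [← radius_smul_radialProj hκ hc]
      ext i
      rcases i with i | i <;> fin_cases i <;>
        simp [coordVector, crossProduct, Fin.sum_univ_three] <;> ring
    rw [hs, hs 1]
    simp only [eta_smul_left, eta_smul_right, ← mul_assoc]
    exact ⟨mul_neg_of_pos_of_neg (by positivity) hh.1, mul_neg_of_pos_of_neg (by positivity) hh.2⟩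
  constructor
  · have := (hval 1 0 (by simp)).2
    simpa [eta_apply, coordVector, crossProduct] using this
  · intro s t hst
    have := (hval s t hst).1
    simp [eta_apply, coordVector, crossProduct, dotProduct, Fin.sum_univ_three] at this ⊢
    linarith

/-! ### The quadratic map from Majorana spinors to `so(3,2)` -/

/-- The `A`-component of the square of the Majorana spinor `v`. -/
def majoranaA (v : Fin 4 → ℝ) : ℝ := v 0 ^ 2 + v 1 ^ 2 + v 2 ^ 2 + v 3 ^ 2

/-- The `B`-component of the square of the Majorana spinor `v`. -/
def majoranaB (v : Fin 4 → ℝ) : Fin 3 → ℝ :=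
  ![v 0 ^ 2 + v 1 ^ 2 - v 2 ^ 2 - v 3 ^ 2, 2 * (v 0 * v 2 + v 1 * v 3),
    2 * (v 0 * v 3 - v 1 * v 2)]

/-- The `C`-component of the square of the Majorana spinor `v`. -/
def majoranaC (v : Fin 4 → ℝ) : Fin 3 → ℝ :=
  ![2 * (v 0 * v 3 + v 1 * v 2), 2 * (v 2 * v 3 - v 0 * v 1),
    -(v 0 ^ 2 - v 1 ^ 2 + v 2 ^ 2 - v 3 ^ 2)]

/-- The `D`-component of the square of the Majorana spinor `v`. -/
def majoranaD (v : Fin 4 → ℝ) : Fin 3 → ℝ :=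
  ![2 * (v 0 * v 2 - v 1 * v 3), v 2 ^ 2 - v 3 ^ 2 - v 0 ^ 2 + v 1 ^ 2,
    2 * (v 0 * v 1 + v 2 * v 3)]

/-- The pairing of an element of `so(3,2)` with the square of a Majorana spinor. -/
def majoranaPairing (v : Fin 4 → ℝ) (M : so32) : ℝ :=
  coordA M * majoranaA v + coordB M ⬝ᵥ majoranaB v + coordC M ⬝ᵥ majoranaC v +
    coordD M ⬝ᵥ majoranaD v

theorem isLinearMap_majoranaPairing (v : Fin 4 → ℝ) : IsLinearMap ℝ (majoranaPairing v) where
  map_add M N := by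
    simp only [majoranaPairing, map_add, add_dotProduct]
    ring
  map_smul c M := by
    simp only [majoranaPairing, map_smul, smul_dotProduct, smul_eq_mul]
    ring

theorem majoranaA_pos {v : Fin 4 → ℝ} (hv : v ≠ 0) : 0 < majoranaA v := by
  obtain ⟨i, hi⟩ := Function.ne_iff.1 hv
  have := sq_pos_of_ne_zero (show v i ≠ 0 from hi)
  unfold majoranaA
  fin_cases i <;> simp at this <;> positivity

/-- The pairing with squares of Majorana spinors is positive on timelike simple elements: there
`A a` times the pairing is the determinant of a `2 × 2` matrix with positive definite symmetric
part. -/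
theorem majoranaPairing_pos {M : so32} (hA : 0 < coordA M)
    (hT : ∀ s t : ℝ, (s ≠ 0 ∨ t ≠ 0) → (s • coordB M + t • coordC M) ⬝ᵥ
      (s • coordB M + t • coordC M) < coordA M ^ 2 * (s ^ 2 + t ^ 2))
    (hP : coordA M • coordD M = coordC M ⨯₃ coordB M) {v : Fin 4 → ℝ} (hv : v ≠ 0) :
    0 < majoranaPairing v M := by
  have ha := majoranaA_pos hv
  unfold majoranaPairing
  generalize coordA M = A at *
  generalize coordB M = B at *
  generalize coordC M = C at *
  generalize coordD M = D at *
  -- For a Majorana square, `b` and `c` are orthogonal vectors of length `a`, and `a d = c × b`.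
  have hnorm : ∀ s t : ℝ, ∑ i, (s • majoranaB v + t • majoranaC v) i ^ 2 =
      majoranaA v ^ 2 * (s ^ 2 + t ^ 2) := by
    intro s t
    simp [majoranaA, majoranaB, majoranaC, Fin.sum_univ_three]
    ring
  have hd : ∀ i, majoranaA v * majoranaD v i = (majoranaC v ⨯₃ majoranaB v) i := by
    intro i
    fin_cases i <;> simp [majoranaA, majoranaB, majoranaC, majoranaD, crossProduct] <;> ring
  generalize majoranaA v = a at *
  generalize majoranaB v = b at *
  generalize majoranaC v = c at *
  generalize majoranaD v = d at *
  have hg : ∀ s t : ℝ, (s ≠ 0 ∨ t ≠ 0) →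
      0 < A * a * (s ^ 2 + t ^ 2) + (s • B + t • C) ⬝ᵥ (s • b + t • c) := by
    intro s t hst
    have hq : 0 < s ^ 2 + t ^ 2 := by rcases hst with h | h <;> positivity
    have hcs := Finset.sum_mul_sq_le_sq_mul_sq Finset.univ (s • B + t • C) (s • b + t • c)
    rw [hnorm] at hcs
    have hlt := hT s t hst
    have heq : (s • B + t • C) ⬝ᵥ (s • B + t • C) = ∑ i, (s • B + t • C) i ^ 2 :=
      Finset.sum_congr rfl fun i _ => (sq _).symm
    rw [heq] at hlt
    have hsq : ((s • B + t • C) ⬝ᵥ (s • b + t • c)) ^ 2 < (A * a * (s ^ 2 + t ^ 2)) ^ 2 :=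
      hcs.trans_lt <| (mul_lt_mul_of_pos_right hlt (by positivity)).trans_eq (by ring)
    have := (abs_lt_of_sq_lt_sq' hsq (by positivity)).1
    linarith
  have h1 : 0 < A * a + B ⬝ᵥ b := by simpa using hg 1 0 (by simp)
  set m := (B ⬝ᵥ c + C ⬝ᵥ b) / 2
  -- A form `n₁₁ s² + 2 m s t + n₂₂ t²` takes the value `n₁₁ (n₁₁ n₂₂ - m²)` at `(-m, n₁₁)`, so
  -- positivity gives a positive determinant.
  have h2 := hg (-m) (A * a + B ⬝ᵥ b) (Or.inr h1.ne')
  have h3 : A * a * ((-m) ^ 2 + (A * a + B ⬝ᵥ b) ^ 2) +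
      ((-m) • B + (A * a + B ⬝ᵥ b) • C) ⬝ᵥ ((-m) • b + (A * a + B ⬝ᵥ b) • c) =
      (A * a + B ⬝ᵥ b) * ((A * a + B ⬝ᵥ b) * (A * a + C ⬝ᵥ c) - m ^ 2) := by
    simp only [add_dotProduct, dotProduct_add, smul_dotProduct, dotProduct_smul, smul_eq_mul, m]
    ring
  rw [h3] at h2
  have h4 := pos_of_mul_pos_right h2 h1.le
  -- Binet–Cauchy: `(C × B) · (c × b) = (C · c)(B · b) - (C · b)(B · c)`.
  have h5 : A * a * (A * a + B ⬝ᵥ b + C ⬝ᵥ c + D ⬝ᵥ d) =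
      (A * a + B ⬝ᵥ b) * (A * a + C ⬝ᵥ c) - (B ⬝ᵥ c) * (C ⬝ᵥ b) := by
    have hDi : ∀ i, A * D i = (C ⨯₃ B) i := fun i => congrFun hP i
    have hDd : A * a * (D ⬝ᵥ d) = ∑ i, (A * D i) * (a * d i) := by
      rw [dotProduct, Finset.mul_sum]
      exact Finset.sum_congr rfl fun i _ => by ring
    rw [mul_add, hDd]
    simp only [hDi, hd]
    simp [crossProduct, dotProduct, Fin.sum_univ_three]
    ring
  have h6 : 0 < A * a * (A * a + B ⬝ᵥ b + C ⬝ᵥ c + D ⬝ᵥ d) := by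
    rw [h5]
    -- The determinant of a `2 × 2` matrix exceeds that of its symmetric part by the square of half
    -- the difference of the off-diagonal entries.
    have := sq_nonneg (B ⬝ᵥ c - C ⬝ᵥ b)
    simp only [m] at h4
    nlinarith
  exact pos_of_mul_pos_right h6 (by positivity)

theorem majoranaPairing_pos_of_mem_observerSet (hκ : 0 < κ) {M : so32}
    (hM : M ∈ observerSet κ) {v : Fin 4 → ℝ} (hv : v ≠ 0) : 0 < majoranaPairing v M := by
  obtain ⟨-, hO, hF, -⟩ := hM
  obtain ⟨hA, hT⟩ := timelike_bounds hκ (by rwa [coord_eq_self])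
  let y : Spacetime κ := ⟨_, chart_mem hκ 0⟩
  obtain ⟨p, q, hpq⟩ := exists_factor_of_isHypersurfaceOrthogonal hκ hO y (hF y).1.ne
  exact majoranaPairing_pos hA hT (coordA_smul_coordD_of_factor hpq) hv

/-! ### Derivatives of the static chart and frame -/

/-- Reduces Fréchet derivatives along the chart to one-variable calculus, once smoothness is known.
-/
theorem fderiv_eq_of_hasLineDerivAt {E F : Type*} [NormedAddCommGroup E] [NormedSpace ℝ E]
    [NormedAddCommGroup F] [NormedSpace ℝ F] {f : E → F} {f' : F} {p v : E}
    (hf : DifferentiableAt ℝ f p) (h : HasLineDerivAt ℝ f f' p v) : fderiv ℝ f p v = f' := by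
  rw [← hf.lineDeriv_eq_fderiv, h.lineDeriv]

theorem hasLineDerivAt_fst (p v : Static) : HasLineDerivAt ℝ Prod.fst v.1 p v := by
  have : HasDerivAt (fun t : ℝ => p.1 + t * v.1) (1 * v.1) 0 :=
    ((hasDerivAt_id (0 : ℝ)).mul_const v.1).const_add p.1
  simpa [HasLineDerivAt] using this

theorem hasLineDerivAt_snd (p v : Static) (i : Fin 3) :
    HasLineDerivAt ℝ (fun q : Static => q.2 i) (v.2 i) p v := by
  have : HasDerivAt (fun t : ℝ => p.2 i + t * v.2 i) (1 * v.2 i) 0 :=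
    ((hasDerivAt_id (0 : ℝ)).mul_const (v.2 i)).const_add (p.2 i)
  simpa [HasLineDerivAt] using this

theorem hasLineDerivAt_lapse (hκ : 0 < κ) (p v : Static) :
    HasLineDerivAt ℝ (lapse κ) (κ * (p.2 ⬝ᵥ v.2) / lapse κ p) p v := by
  have h1 : HasDerivAt (fun t : ℝ => 1 + κ * ∑ i, (p + t • v).2 i ^ 2)
      (κ * ∑ i, 2 * p.2 i * v.2 i) 0 := by
    refine ((HasDerivAt.fun_sum fun i _ => ?_).const_mul κ).const_add 1
    have := HasDerivAt.fun_pow (hasLineDerivAt_snd p v i) 2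
    simpa using this
  have h2 := h1.sqrt (by simpa using (one_add_pos hκ p).ne')
  refine h2.congr_deriv ?_
  have hL := lapse_pos hκ p
  simp only [zero_smul, add_zero]
  change _ / (2 * lapse κ p) = _
  simp only [dotProduct, mul_assoc, ← Finset.mul_sum]
  field_simp

theorem contDiff_chart (hκ : 0 < κ) : ContDiff ℝ ∞ (chart κ) := by
  have := contDiff_lapse hκ
  refine contDiff_pi.2 fun i => ?_
  rcases i with i | i
  · simp only [chart, Sum.elim_inl]
    fun_prop
  · fin_cases i <;> simp only [chart, Sum.elim_inr, Fin.zero_eta, Fin.mk_one, Matrix.cons_val_zero,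
      Matrix.cons_val_one] <;> fun_prop

theorem contDiff_frame (hκ : 0 < κ) (a : Fin 4) : ContDiff ℝ ∞ fun q => frame κ q a := by
  have := contDiff_lapse hκ
  have h0 : ∀ q : Static, 1 + lapse κ q ≠ 0 := fun q => by
    have := lapse_pos hκ q
    positivity
  refine contDiff_pi.2 fun i => ?_
  refine Fin.cases ?_ (fun a => ?_) a
  · rcases i with i | i
    · simp only [frame, Fin.cons_zero, Sum.elim_inl]
      exact contDiff_const
    · fin_cases i <;> simp only [frame, Fin.cons_zero, Sum.elim_inr, Fin.zero_eta, Fin.mk_one,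
        Matrix.cons_val_zero, Matrix.cons_val_one] <;> fun_prop
  · rcases i with i | i
    · simp only [frame, Fin.cons_succ, Sum.elim_inl, Pi.add_apply, Pi.smul_apply, smul_eq_mul]
      fun_prop (disch := exact h0)
    · fin_cases i <;> simp only [frame, Fin.cons_succ, Sum.elim_inr, Fin.zero_eta, Fin.mk_one,
        Matrix.cons_val_zero, Matrix.cons_val_one] <;> fun_prop

theorem hasLineDerivAt_cos (p v : Static) : HasLineDerivAt ℝ (fun q : Static => Real.cos (√κ * q.1))
    (-Real.sin (√κ * p.1) * (√κ * v.1)) p v := by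
  have := HasDerivAt.cos (HasDerivAt.const_mul √κ (hasLineDerivAt_fst p v))
  simpa [HasLineDerivAt] using this

theorem hasLineDerivAt_sin (p v : Static) : HasLineDerivAt ℝ (fun q : Static => Real.sin (√κ * q.1))
    (Real.cos (√κ * p.1) * (√κ * v.1)) p v := by
  have := HasDerivAt.sin (HasDerivAt.const_mul √κ (hasLineDerivAt_fst p v))
  simpa [HasLineDerivAt] using this

theorem fderiv_chart (hκ : 0 < κ) (p v : Static) :
    fderiv ℝ (chart κ) p v = Sum.elim v.2
      ![√κ * (p.2 ⬝ᵥ v.2) / lapse κ p * Real.cos (√κ * p.1) -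
          lapse κ p * Real.sin (√κ * p.1) * v.1,
        √κ * (p.2 ⬝ᵥ v.2) / lapse κ p * Real.sin (√κ * p.1) +
          lapse κ p * Real.cos (√κ * p.1) * v.1] := by
  refine fderiv_eq_of_hasLineDerivAt ((contDiff_chart hκ).differentiable (by simp) p) ?_
  have hs : √κ ≠ 0 := (Real.sqrt_pos.2 hκ).ne'
  have hL := (lapse_pos hκ p).ne'
  have hk : κ = √κ * √κ := (Real.mul_self_sqrt hκ.le).symm
  refine hasDerivAt_pi.2 fun i => ?_
  rcases i with i | i
  · exact hasLineDerivAt_snd p v i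
  · fin_cases i
    · refine ((HasDerivAt.div_const (hasLineDerivAt_lapse hκ p v) √κ).mul
        (hasLineDerivAt_cos p v)).congr_deriv ?_
      simp
      field_simp
      linear_combination (p.2 ⬝ᵥ v.2 * Real.cos (√κ * p.1)) * hk
    · refine ((HasDerivAt.div_const (hasLineDerivAt_lapse hκ p v) √κ).mul
        (hasLineDerivAt_sin p v)).congr_deriv ?_
      simp
      field_simp
      linear_combination (p.2 ⬝ᵥ v.2 * Real.sin (√κ * p.1)) * hk

theorem fderiv_frame_zero (hκ : 0 < κ) (p v : Static) :
    fderiv ℝ (fun q => frame κ q 0) p v = (Sum.elim 0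
      ![-(√κ * Real.cos (√κ * p.1) * v.1), -(√κ * Real.sin (√κ * p.1) * v.1)] : Ambient) := by
  refine fderiv_eq_of_hasLineDerivAt ((contDiff_frame hκ 0).differentiable (by simp) p) ?_
  refine hasDerivAt_pi.2 fun i => ?_
  rcases i with i | i
  · exact hasDerivAt_const (0 : ℝ) (0 : ℝ)
  · fin_cases i
    · refine (HasDerivAt.neg (hasLineDerivAt_sin p v)).congr_deriv ?_
      simp
      ring
    · refine (hasLineDerivAt_cos p v).congr_deriv ?_
      simp
      ring

theorem fderiv_frame_succ (hκ : 0 < κ) (p v : Static) (i : Fin 3) :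
    fderiv ℝ (fun q => frame κ q i.succ) p v = Sum.elim
      ((κ / (1 + lapse κ p) * v.2 i -
          κ * p.2 i * (κ * (p.2 ⬝ᵥ v.2) / lapse κ p) / (1 + lapse κ p) ^ 2) • p.2 +
        (κ * p.2 i / (1 + lapse κ p)) • v.2)
      ![√κ * (v.2 i * Real.cos (√κ * p.1)) - κ * p.2 i * Real.sin (√κ * p.1) * v.1,
        √κ * (v.2 i * Real.sin (√κ * p.1)) + κ * p.2 i * Real.cos (√κ * p.1) * v.1] := by
  refine fderiv_eq_of_hasLineDerivAt ((contDiff_frame hκ i.succ).differentiable (by simp) p) ?_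
  have hL := lapse_pos hκ p
  have hL1 : 1 + lapse κ p ≠ 0 := by positivity
  have hk : κ = √κ * √κ := (Real.mul_self_sqrt hκ.le).symm
  refine hasDerivAt_pi.2 fun j => ?_
  rcases j with j | j
  · have h1 := HasDerivAt.const_mul κ (hasLineDerivAt_snd p v i)
    have h2 := HasDerivAt.const_add 1 (hasLineDerivAt_lapse hκ p v)
    have h3 := h1.fun_div h2 (by simpa using hL1)
    refine (HasDerivAt.const_add ((Pi.single i 1 : Fin 3 → ℝ) j)
      (h3.mul (hasLineDerivAt_snd p v j))).congr_deriv ?_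
    simp only [zero_smul, add_zero, Sum.elim_inl, Pi.add_apply, Pi.smul_apply, smul_eq_mul]
    field_simp
  · fin_cases j
    · refine ((HasDerivAt.const_mul √κ (hasLineDerivAt_snd p v i)).mul
        (hasLineDerivAt_cos p v)).congr_deriv ?_
      simp
      linear_combination (p.2 i * Real.sin (√κ * p.1) * v.1) * hk
    · refine ((HasDerivAt.const_mul √κ (hasLineDerivAt_snd p v i)).mul
        (hasLineDerivAt_sin p v)).congr_deriv ?_
      simp
      linear_combination -(p.2 i * Real.cos (√κ * p.1) * v.1) * hk

/-! ### Coframe and connection coefficients -/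

theorem coframe_zero (hκ : 0 < κ) (p v : Static) : coframe κ p v 0 = lapse κ p * v.1 := by
  have h := Real.sin_sq_add_cos_sq (√κ * p.1)
  rw [coframe, fderiv_chart hκ]
  simp [sign, frame, eta_apply]
  linear_combination (lapse κ p * v.1) * h

theorem coframe_succ (hκ : 0 < κ) (p v : Static) (i : Fin 3) :
    coframe κ p v i.succ =
      v.2 i - κ * p.2 i * (p.2 ⬝ᵥ v.2) / (lapse κ p * (1 + lapse κ p)) := by
  have h := Real.sin_sq_add_cos_sq (√κ * p.1)
  have hL := lapse_pos hκ p
  have hL1 : 1 + lapse κ p ≠ 0 := by positivity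
  have hk : √κ * √κ = κ := Real.mul_self_sqrt hκ.le
  have hsgn : sign i.succ = 1 := by fin_cases i <;> rfl
  have hdot : v.2 ⬝ᵥ (Pi.single i 1 + (κ * p.2 i / (1 + lapse κ p)) • p.2) =
      v.2 i + κ * p.2 i / (1 + lapse κ p) * (p.2 ⬝ᵥ v.2) := by
    rw [dotProduct_add, dotProduct_smul, dotProduct_single_one, dotProduct_comm v.2, smul_eq_mul]
  have key : eta (fderiv ℝ (chart κ) p v) (frame κ p i.succ) =
      v.2 ⬝ᵥ (Pi.single i 1 + (κ * p.2 i / (1 + lapse κ p)) • p.2) -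
        κ * p.2 i * (p.2 ⬝ᵥ v.2) / lapse κ p := by
    rw [fderiv_chart hκ, frame, Fin.cons_succ]
    simp only [eta, dotProduct, Sum.elim_inl, Sum.elim_inr, Fin.sum_univ_two,
      Matrix.cons_val_zero, Matrix.cons_val_one]
    linear_combination (-(p.2 i * (∑ j, p.2 j * v.2 j) / lapse κ p) *
      (Real.sin (√κ * p.1) ^ 2 + Real.cos (√κ * p.1) ^ 2)) * hk -
      κ * p.2 i * (∑ j, p.2 j * v.2 j) / lapse κ p * h
  rw [coframe, hsgn, one_mul, key, hdot]
  field_simp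
  ring

theorem connection_zero_zero (hκ : 0 < κ) (p v : Static) : connection κ p v 0 0 = 0 := by
  rw [connection, fderiv_frame_zero hκ]
  simp [frame, eta_apply]
  ring

theorem connection_zero_succ (hκ : 0 < κ) (p v : Static) (i : Fin 3) :
    connection κ p v 0 i.succ = κ * v.1 * p.2 i := by
  have h := Real.sin_sq_add_cos_sq (√κ * p.1)
  have hk : √κ * √κ = κ := Real.mul_self_sqrt hκ.le
  rw [connection, fderiv_frame_zero hκ]
  simp only [frame, Fin.cons_succ, eta, Sum.elim_inl, Sum.elim_inr, Fin.sum_univ_two,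
    Matrix.cons_val_zero, Matrix.cons_val_one, Pi.zero_apply, zero_mul, Finset.sum_const_zero]
  linear_combination v.1 * p.2 i *
    ((Real.sin (√κ * p.1) ^ 2 + Real.cos (√κ * p.1) ^ 2) * hk + κ * h)

theorem connection_succ_zero (hκ : 0 < κ) (p v : Static) (i : Fin 3) :
    connection κ p v i.succ 0 = -(κ * v.1 * p.2 i) := by
  have h := Real.sin_sq_add_cos_sq (√κ * p.1)
  rw [connection, fderiv_frame_succ hκ]
  simp only [frame, Fin.cons_zero, eta, Sum.elim_inl, Sum.elim_inr, Fin.sum_univ_two,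
    Matrix.cons_val_zero, Matrix.cons_val_one, Pi.zero_apply, mul_zero, Finset.sum_const_zero]
  linear_combination -(κ * v.1 * p.2 i) * h

theorem connection_succ_succ (hκ : 0 < κ) (p v : Static) (i j : Fin 3) :
    connection κ p v i.succ j.succ =
      κ / (1 + lapse κ p) * (p.2 i * v.2 j - p.2 j * v.2 i) := by
  have h := Real.sin_sq_add_cos_sq (√κ * p.1)
  have hL := lapse_pos hκ p
  have hL1 : 1 + lapse κ p ≠ 0 := by positivity
  have hk : √κ * √κ = κ := Real.mul_self_sqrt hκ.le
  have hLs : lapse κ p ^ 2 = 1 + κ * (p.2 ⬝ᵥ p.2) := by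
    rw [lapse_sq hκ]
    simp only [dotProduct, sq]
  have hdot : ∀ a b c : ℝ, (a • p.2 + b • v.2) ⬝ᵥ (Pi.single j 1 + c • p.2) =
      a * p.2 j + b * v.2 j + c * (a * (p.2 ⬝ᵥ p.2) + b * (p.2 ⬝ᵥ v.2)) := by
    intro a b c
    simp only [dotProduct_add, add_dotProduct, smul_dotProduct, dotProduct_smul,
      dotProduct_single_one, dotProduct_comm v.2, smul_eq_mul, Pi.add_apply, Pi.smul_apply]
  have key : ∀ u : Fin 3 → ℝ, eta (Sum.elim u
      ![√κ * (v.2 i * Real.cos (√κ * p.1)) - κ * p.2 i * Real.sin (√κ * p.1) * v.1,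
        √κ * (v.2 i * Real.sin (√κ * p.1)) + κ * p.2 i * Real.cos (√κ * p.1) * v.1])
      (frame κ p j.succ) =
      u ⬝ᵥ (Pi.single j 1 + (κ * p.2 j / (1 + lapse κ p)) • p.2) - κ * p.2 j * v.2 i := by
    intro u
    rw [frame, Fin.cons_succ]
    simp only [eta, dotProduct, Sum.elim_inl, Sum.elim_inr, Fin.sum_univ_two,
      Matrix.cons_val_zero, Matrix.cons_val_one]
    linear_combination -(p.2 j * v.2 i) *
      ((Real.sin (√κ * p.1) ^ 2 + Real.cos (√κ * p.1) ^ 2) * hk + κ * h)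
  rw [connection, fderiv_frame_succ hκ, key, hdot]
  generalize p.2 ⬝ᵥ p.2 = r at *
  generalize p.2 ⬝ᵥ v.2 = d at *
  generalize lapse κ p = L at *
  field_simp
  linear_combination (κ * p.2 i * d * p.2 j - L * (1 + L) * v.2 i * p.2 j) * hLs

/-! ### Imaginary Killing spinors -/

theorem gamma_zero_mulVec (s : Fin 4 → ℂ) : gamma 0 *ᵥ s = ![s 2, s 3, s 0, s 1] := by
  ext k
  fin_cases k <;> simp [gamma, Matrix.mulVec, dotProduct, Fin.sum_univ_four]

theorem gamma_one_mulVec (s : Fin 4 → ℂ) : gamma 1 *ᵥ s = ![s 2, -s 3, -s 0, s 1] := by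
  ext k
  fin_cases k <;> simp [gamma, Matrix.mulVec, dotProduct, Fin.sum_univ_four]

theorem gamma_two_mulVec (s : Fin 4 → ℂ) : gamma 2 *ᵥ s = ![s 3, s 2, -s 1, -s 0] := by
  ext k
  fin_cases k <;> simp [gamma, Matrix.mulVec, dotProduct, Fin.sum_univ_four]

theorem gamma_three_mulVec (s : Fin 4 → ℂ) : gamma 3 *ᵥ s =
    ![-(Complex.I * s 3), Complex.I * s 2, Complex.I * s 1, -(Complex.I * s 0)] := by
  ext k
  fin_cases k <;> simp [gamma, Matrix.mulVec, dotProduct, Fin.sum_univ_four]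

/-- Clifford multiplication by the spatial vector `x` in the orthonormal frame. -/
def spatialClifford (x : Fin 3 → ℝ) (s : Fin 4 → ℂ) : Fin 4 → ℂ :=
  (x 0 : ℂ) • (gamma 1 *ᵥ s) + (x 1 : ℂ) • (gamma 2 *ᵥ s) + (x 2 : ℂ) • (gamma 3 *ᵥ s)

theorem spatialClifford_apply (x : Fin 3 → ℝ) (s : Fin 4 → ℂ) : spatialClifford x s =
    ![x 0 * s 2 + x 1 * s 3 - Complex.I * x 2 * s 3,
      -(x 0 * s 3) + x 1 * s 2 + Complex.I * x 2 * s 2,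
      -(x 0 * s 0) - x 1 * s 1 + Complex.I * x 2 * s 1,
      x 0 * s 1 - x 1 * s 0 - Complex.I * x 2 * s 0] := by
  rw [spatialClifford, gamma_one_mulVec, gamma_two_mulVec, gamma_three_mulVec]
  ext k
  fin_cases k <;> simp <;> ring

theorem clifford_eq (hκ : 0 < κ) (p v : Static) (s : Fin 4 → ℂ) :
    clifford κ p v s = (lapse κ p * v.1 : ℂ) • (gamma 0 *ᵥ s) + spatialClifford v.2 s -
      (κ * (p.2 ⬝ᵥ v.2 : ℝ) / (lapse κ p * (1 + lapse κ p)) : ℂ) • spatialClifford p.2 s := by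
  rw [clifford, Fin.sum_univ_succ, Fin.sum_univ_three, coframe_zero hκ]
  simp only [coframe_succ hκ]
  rw [show (Fin.succ 0 : Fin 4) = 1 from rfl, show (Fin.succ 1 : Fin 4) = 2 from rfl,
    show (Fin.succ 2 : Fin 4) = 3 from rfl]
  simp only [spatialClifford]
  push_cast
  module

/-- The index pairs `(0, i)` and `(i, 0)` contribute equally, since `γ₀` anticommutes with `γᵢ` and
the coefficients are antisymmetric. The spatial pairs assemble into a commutator of Clifford
multiplications. -/
theorem spinDeriv_eq (hκ : 0 < κ) (ψ : Static → Fin 4 → ℂ) (p v : Static) :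
    spinDeriv κ ψ p v = fderiv ℝ ψ p v -
      (κ * v.1 / 2 : ℂ) • (gamma 0 *ᵥ spatialClifford p.2 (ψ p)) +
      (κ / (4 * (1 + lapse κ p)) : ℂ) • (spatialClifford p.2 (spatialClifford v.2 (ψ p)) -
        spatialClifford v.2 (spatialClifford p.2 (ψ p))) := by
  rw [spinDeriv, sub_eq_add_neg, add_assoc]
  congr 1
  simp only [Fin.sum_univ_succ (n := 3), Fin.sum_univ_three, connection_zero_zero hκ,
    connection_zero_succ hκ, connection_succ_zero hκ, connection_succ_succ hκ]
  generalize ψ p = s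
  simp only [spatialClifford_apply]
  rw [show (Fin.succ 0 : Fin 4) = 1 from rfl, show (Fin.succ 1 : Fin 4) = 2 from rfl,
    show (Fin.succ 2 : Fin 4) = 3 from rfl]
  simp only [gamma_zero_mulVec, gamma_one_mulVec, gamma_two_mulVec, gamma_three_mulVec]
  have hL : (1 + lapse κ p : ℂ) ≠ 0 := by
    have := lapse_pos hκ p
    exact_mod_cast (show (1 + lapse κ p) ≠ 0 by positivity)
  ext k
  fin_cases k <;> simp [sign] <;> field_simp <;> ring

/-- The function `cosh (ρ / 2)`, where `sinh ρ = √κ r`. -/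
def halfCosh (κ : ℝ) (p : Static) : ℝ := √((1 + lapse κ p) / 2)

theorem halfCosh_pos (hκ : 0 < κ) (p : Static) : 0 < halfCosh κ p :=
  Real.sqrt_pos.2 (by have := lapse_pos hκ p; positivity)

theorem lapse_eq_halfCosh (hκ : 0 < κ) (p : Static) : lapse κ p = 2 * halfCosh κ p ^ 2 - 1 := by
  rw [halfCosh, Real.sq_sqrt (by have := lapse_pos hκ p; positivity)]
  ring

theorem contDiff_halfCosh (hκ : 0 < κ) : ContDiff ℝ ∞ (halfCosh κ) :=
  ((contDiff_const.add (contDiff_lapse hκ)).div_const 2).sqrt fun p => by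
    have := lapse_pos hκ p
    positivity

theorem kappa_mul_sq_eq_halfCosh (hκ : 0 < κ) (p : Static) :
    κ * (p.2 0 ^ 2 + p.2 1 ^ 2 + p.2 2 ^ 2) = 4 * halfCosh κ p ^ 2 * (halfCosh κ p ^ 2 - 1) := by
  have h := lapse_sq hκ p
  rw [lapse_eq_halfCosh hκ, Fin.sum_univ_three] at h
  linarith

theorem hasLineDerivAt_halfCosh (hκ : 0 < κ) (p v : Static) :
    HasLineDerivAt ℝ (halfCosh κ) (κ * (p.2 ⬝ᵥ v.2) / (4 * lapse κ p * halfCosh κ p)) p v := by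
  have hL := lapse_pos hκ p
  have hc := halfCosh_pos hκ p
  have h1 := ((HasDerivAt.const_add 1 (hasLineDerivAt_lapse hκ p v)).div_const 2).sqrt (by
    simp only [zero_smul, add_zero]
    positivity)
  refine h1.congr_deriv ?_
  simp only [zero_smul, add_zero]
  change _ / (2 * halfCosh κ p) = _
  field_simp
  norm_num

/-- The time dependence `exp (i τ γ₀ / 2)` of a Killing spinor. -/
def spinRotation (τ : ℝ) (s : Fin 4 → ℂ) : Fin 4 → ℂ :=
  (Real.cos (τ / 2) : ℂ) • s + (Complex.I * (Real.sin (τ / 2) : ℂ)) • (gamma 0 *ᵥ s)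

/-- The spinor `c s + i m x.s`. -/
def spinBoost (c m : ℝ) (x : Fin 3 → ℝ) (s : Fin 4 → ℂ) : Fin 4 → ℂ :=
  (c : ℂ) • s + (Complex.I * (m : ℂ)) • spatialClifford x s

/-- The imaginary Killing spinor with value `s` at the origin. -/
def killingSpinor (κ : ℝ) (s : Fin 4 → ℂ) (p : Static) : Fin 4 → ℂ :=
  spinBoost (halfCosh κ p) (√κ / (2 * halfCosh κ p)) p.2 (spinRotation (√κ * p.1) s)

theorem contDiff_ofReal_comp {E : Type*} [NormedAddCommGroup E] [NormedSpace ℝ E] {f : E → ℝ}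
    (hf : ContDiff ℝ ∞ f) : ContDiff ℝ ∞ fun q => (f q : ℂ) :=
  Complex.ofRealCLM.contDiff.comp hf

theorem contDiff_killingSpinor (hκ : 0 < κ) (s : Fin 4 → ℂ) :
    ContDiff ℝ ∞ (killingSpinor κ s) := by
  have hc := contDiff_halfCosh hκ
  have h1 := contDiff_ofReal_comp hc
  have h2 : ContDiff ℝ ∞ fun p => ((√κ / (2 * halfCosh κ p) : ℝ) : ℂ) :=
    contDiff_ofReal_comp (contDiff_const.div (contDiff_const.mul hc) fun p => by
      have := halfCosh_pos hκ p
      positivity)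
  have h3 : ContDiff ℝ ∞ fun p : Static => (Real.cos (√κ * p.1 / 2) : ℂ) :=
    contDiff_ofReal_comp (by fun_prop)
  have h4 : ContDiff ℝ ∞ fun p : Static => (Real.sin (√κ * p.1 / 2) : ℂ) :=
    contDiff_ofReal_comp (by fun_prop)
  have h5 : ∀ i, ContDiff ℝ ∞ fun p : Static => (p.2 i : ℂ) := fun i =>
    contDiff_ofReal_comp (by fun_prop)
  refine contDiff_pi.2 fun k => ?_
  fin_cases k <;>
    simp only [killingSpinor, spinBoost, spinRotation, spatialClifford_apply, gamma_zero_mulVec,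
      Pi.add_apply, Pi.smul_apply, smul_eq_mul, Fin.zero_eta, Fin.mk_one, Fin.reduceFinMk,
      Matrix.cons_val] <;> fun_prop

/-- The derivative of the Killing spinor along `v`, in terms of the rotated spinor `φ`. -/
theorem fderiv_killingSpinor (hκ : 0 < κ) (s : Fin 4 → ℂ) (p v : Static) {φ : Fin 4 → ℂ}
    (hφ : φ = spinRotation (√κ * p.1) s) {c c' : ℝ} (hc : c = halfCosh κ p)
    (hc' : c' = κ * (p.2 ⬝ᵥ v.2) / (4 * lapse κ p * halfCosh κ p)) :
    fderiv ℝ (killingSpinor κ s) p v = (c' : ℂ) • φ +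
      (c * (Complex.I * √κ * v.1 / 2) : ℂ) • (gamma 0 *ᵥ φ) +
      (-(Complex.I * √κ * c' / (2 * c ^ 2))) • spatialClifford p.2 φ +
      (Complex.I * √κ / (2 * c)) • (spatialClifford v.2 φ +
        (Complex.I * √κ * v.1 / 2) • spatialClifford p.2 (gamma 0 *ᵥ φ)) := by
  refine fderiv_eq_of_hasLineDerivAt ((contDiff_killingSpinor hκ s).differentiable (by simp) p) ?_
  have hc0 : c ≠ 0 := by
    rw [hc]
    exact (halfCosh_pos hκ p).ne'
  have hh : HasLineDerivAt ℝ (halfCosh κ) c' p v := by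
    rw [hc']
    exact hasLineDerivAt_halfCosh hκ p v
  have h1 : HasDerivAt (fun t : ℝ => (halfCosh κ (p + t • v) : ℂ)) (c' : ℂ) 0 :=
    HasDerivAt.ofReal_comp hh
  have h2 : HasDerivAt (fun t : ℝ => ((√κ / (2 * halfCosh κ (p + t • v)) : ℝ) : ℂ))
      (-(√κ * c' / (2 * c ^ 2)) : ℂ) 0 := by
    have := HasDerivAt.ofReal_comp (HasDerivAt.fun_div (hasDerivAt_const 0 √κ)
      (HasDerivAt.const_mul 2 hh) (by simpa [← hc] using hc0))
    refine this.congr_deriv ?_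
    simp only [zero_smul, add_zero, ← hc]
    have : (c : ℂ) ≠ 0 := by exact_mod_cast hc0
    push_cast
    field_simp
    ring
  have hτ : HasDerivAt (fun t : ℝ => √κ * (p + t • v).1 / 2) (√κ * v.1 / 2) 0 :=
    (HasDerivAt.const_mul √κ (hasLineDerivAt_fst p v)).div_const 2
  have h3 := HasDerivAt.ofReal_comp hτ.cos
  have h4 := HasDerivAt.ofReal_comp hτ.sin
  simp only [zero_smul, add_zero] at h3 h4
  have hI := Complex.I_mul_I
  have h5 : ∀ k, HasDerivAt (fun t : ℝ => spinRotation (√κ * (p + t • v).1) s k)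
      ((Complex.I * √κ * v.1 / 2) * (gamma 0 *ᵥ φ) k) 0 := by
    intro k
    refine ((h3.mul_const (s k)).add
      ((h4.const_mul Complex.I).mul_const ((gamma 0 *ᵥ s) k))).congr_deriv ?_
    rw [hφ]
    simp only [spinRotation, gamma_zero_mulVec]
    fin_cases k <;> simp <;> ring_nf <;> simp only [Complex.I_sq] <;> ring
  have h6 : ∀ i, HasDerivAt (fun t : ℝ => ((p + t • v).2 i : ℂ)) (v.2 i : ℂ) 0 := fun i =>
    HasDerivAt.ofReal_comp (hasLineDerivAt_snd p v i)
  have h7 : ∀ k, HasDerivAt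
      (fun t : ℝ => spatialClifford (p + t • v).2 (spinRotation (√κ * (p + t • v).1) s) k)
      (spatialClifford v.2 φ k + (Complex.I * √κ * v.1 / 2) *
        spatialClifford p.2 (gamma 0 *ᵥ φ) k) 0 := by
    intro k
    have hg : ∀ j, HasDerivAt (fun t : ℝ => (gamma j *ᵥ spinRotation (√κ * (p + t • v).1) s) k)
        ((gamma j *ᵥ ((Complex.I * √κ * v.1 / 2) • (gamma 0 *ᵥ φ))) k) 0 := fun j =>
      HasDerivAt.fun_sum (u := Finset.univ) fun l _ => (h5 l).const_mul (gamma j k l)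
    refine ((((h6 0).mul (hg 1)).add ((h6 1).mul (hg 2))).add ((h6 2).mul (hg 3))).congr_deriv ?_
    simp only [zero_smul, add_zero, ← hφ, spatialClifford, Matrix.mulVec_smul, Pi.add_apply,
      Pi.smul_apply, smul_eq_mul]
    ring
  refine hasDerivAt_pi.2 fun k => ?_
  refine ((h1.mul (h5 k)).add ((h2.const_mul Complex.I).mul (h7 k))).congr_deriv ?_
  simp only [zero_smul, add_zero, ← hφ, ← hc, Pi.add_apply, Pi.smul_apply, smul_eq_mul]
  have : (c : ℂ) ≠ 0 := by exact_mod_cast hc0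
  push_cast
  field_simp
  ring

theorem isKillingSpinor_killingSpinor (hκ : 0 < κ) (s : Fin 4 → ℂ) :
    IsKillingSpinor κ (killingSpinor κ s) := by
  refine ⟨contDiff_killingSpinor hκ s, fun p v => ?_⟩
  have hL := lapse_pos hκ p
  have hc := halfCosh_pos hκ p
  have hLc := lapse_eq_halfCosh hκ p
  have hr := kappa_mul_sq_eq_halfCosh hκ p
  have hk : κ = √κ ^ 2 := (Real.sq_sqrt hκ.le).symm
  rw [spinDeriv_eq hκ, clifford_eq hκ, fderiv_killingSpinor hκ s p v rfl rfl rfl, killingSpinor]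
  generalize spinRotation (√κ * p.1) s = φ
  generalize halfCosh κ p = c at *
  generalize lapse κ p = L at *
  generalize √κ = σ at *
  subst hk
  obtain ⟨t, x⟩ := p
  obtain ⟨v0, w⟩ := v
  simp only at *
  have hc0 : (c : ℂ) ≠ 0 := by exact_mod_cast hc.ne'
  have hL0 : (L : ℂ) ≠ 0 := by exact_mod_cast hL.ne'
  have hL1 : (L : ℂ) = 2 * c ^ 2 - 1 := by exact_mod_cast hLc
  have hL2 : 1 + (L : ℂ) = 2 * c ^ 2 := by rw [hL1]; ring
  have hr' : (σ : ℂ) ^ 2 * (x 0 ^ 2 + x 1 ^ 2 + x 2 ^ 2) = 4 * c ^ 2 * (c ^ 2 - 1) := by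
    exact_mod_cast hr
  have hd : ((x ⬝ᵥ w : ℝ) : ℂ) = x 0 * w 0 + x 1 * w 1 + x 2 * w 2 := by
    simp [dotProduct, Fin.sum_univ_three]
  -- The Killing equation holds only modulo `κ r² = 4 c² (c² - 1)`. This is the multiple of that
  -- relation by which the two sides differ.
  have key : ∀ k, (Complex.I * σ / (4 * c) * v0 * (gamma 0 *ᵥ φ) k +
      Complex.I * σ / (8 * c ^ 3) * spatialClifford w φ k +
      σ ^ 2 * (x 0 * w 0 + x 1 * w 1 + x 2 * w 2) / (8 * c ^ 3 * L) * φ k) *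
      (σ ^ 2 * (x 0 ^ 2 + x 1 ^ 2 + x 2 ^ 2) - 4 * c ^ 2 * (c ^ 2 - 1)) = 0 := by
    intro k
    rw [hr', sub_self, mul_zero]
  ext k
  rw [← sub_eq_zero, ← key k]
  simp only [spinBoost, Pi.add_apply, Pi.sub_apply, Pi.smul_apply, smul_eq_mul, hL2]
  push_cast
  simp only [hd]
  simp only [spatialClifford_apply, gamma_zero_mulVec]
  fin_cases k
  all_goals
    simp
    field_simp
    simp only [hL1]
    ring_nf
    simp only [Complex.I_sq, Complex.I_pow_three, Complex.I_pow_four]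
    ring

/-! ### The Killing field of a Killing spinor -/

/-- The bilinear `ψ† ψ`. -/
def spinA (ψ : Fin 4 → ℂ) : ℝ :=
  (star (ψ 0) * ψ 0 + star (ψ 1) * ψ 1 + star (ψ 2) * ψ 2 + star (ψ 3) * ψ 3).re

/-- The bilinears `-ψ† γ₀ γⱼ ψ`. -/
def spinB (ψ : Fin 4 → ℂ) : Fin 3 → ℝ :=
  ![(star (ψ 0) * ψ 0 - star (ψ 1) * ψ 1 - star (ψ 2) * ψ 2 + star (ψ 3) * ψ 3).re,
    2 * (star (ψ 0) * ψ 1 - star (ψ 2) * ψ 3).re,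
    2 * (star (ψ 0) * ψ 1 - star (ψ 2) * ψ 3).im]

/-- The bilinears `i ψ† γⱼ ψ`. -/
def spinC (ψ : Fin 4 → ℂ) : Fin 3 → ℝ :=
  ![-2 * (star (ψ 0) * ψ 2 - star (ψ 1) * ψ 3).im,
    -2 * (star (ψ 0) * ψ 3 + star (ψ 1) * ψ 2).im,
    2 * (star (ψ 0) * ψ 3 - star (ψ 1) * ψ 2).re]

/-- The bilinears `(i / 2) ε_{pqr} ψ† γ₀ γ_q γ_r ψ`. -/
def spinD (ψ : Fin 4 → ℂ) : Fin 3 → ℝ :=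
  ![2 * (star (ψ 0) * ψ 2 - star (ψ 1) * ψ 3).re,
    2 * (star (ψ 0) * ψ 3 + star (ψ 1) * ψ 2).re,
    2 * (star (ψ 0) * ψ 3 - star (ψ 1) * ψ 2).im]

/-- `exp (i τ γ₀ / 2)` is unitary. The matrices defining `A` and `D` commute with `γ₀`, so these
bilinears are unchanged; those defining `B` and `C` anticommute with it, so `B` and `C` rotate into
each other through the full angle `τ`. -/
theorem spinA_spinRotation (τ : ℝ) (s : Fin 4 → ℂ) : spinA (spinRotation τ s) = spinA s := by
  have h := Real.sin_sq_add_cos_sq (τ / 2)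
  simp only [spinA, spinRotation, gamma_zero_mulVec]
  generalize Real.cos (τ / 2) = c at *
  generalize Real.sin (τ / 2) = σ at *
  simp
  linear_combination ((s 0).re ^ 2 + (s 0).im ^ 2 + (s 1).re ^ 2 + (s 1).im ^ 2 + (s 2).re ^ 2 +
    (s 2).im ^ 2 + (s 3).re ^ 2 + (s 3).im ^ 2) * h

theorem spinB_spinRotation (τ : ℝ) (s : Fin 4 → ℂ) :
    spinB (spinRotation τ s) = Real.cos τ • spinB s + Real.sin τ • spinC s := by
  have hc : Real.cos τ = Real.cos (τ / 2) ^ 2 - Real.sin (τ / 2) ^ 2 := by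
    rw [← Real.cos_two_mul']
    ring_nf
  have hs : Real.sin τ = 2 * Real.sin (τ / 2) * Real.cos (τ / 2) := by
    rw [← Real.sin_two_mul]
    ring_nf
  rw [hc, hs]
  simp only [spinB, spinC, spinRotation, gamma_zero_mulVec]
  generalize Real.cos (τ / 2) = c at *
  generalize Real.sin (τ / 2) = σ at *
  ext i
  fin_cases i <;> simp <;> ring

theorem spinC_spinRotation (τ : ℝ) (s : Fin 4 → ℂ) :
    spinC (spinRotation τ s) = Real.cos τ • spinC s - Real.sin τ • spinB s := by
  have hc : Real.cos τ = Real.cos (τ / 2) ^ 2 - Real.sin (τ / 2) ^ 2 := by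
    rw [← Real.cos_two_mul']
    ring_nf
  have hs : Real.sin τ = 2 * Real.sin (τ / 2) * Real.cos (τ / 2) := by
    rw [← Real.sin_two_mul]
    ring_nf
  rw [hc, hs]
  simp only [spinB, spinC, spinRotation, gamma_zero_mulVec]
  generalize Real.cos (τ / 2) = c at *
  generalize Real.sin (τ / 2) = σ at *
  ext i
  fin_cases i <;> simp <;> ring

theorem spinD_spinRotation (τ : ℝ) (s : Fin 4 → ℂ) : spinD (spinRotation τ s) = spinD s := by
  have h := Real.sin_sq_add_cos_sq (τ / 2)
  have hd : spinD (spinRotation τ s) =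
      (Real.sin (τ / 2) ^ 2 + Real.cos (τ / 2) ^ 2) • spinD s := by
    simp only [spinD, spinRotation, gamma_zero_mulVec]
    generalize Real.cos (τ / 2) = c at *
    generalize Real.sin (τ / 2) = σ at *
    ext i
    fin_cases i <;> simp <;> ring
  rw [hd, h, one_smul]

theorem spinForm_gamma_zero (ψ : Fin 4 → ℂ) : spinForm (gamma 0 *ᵥ ψ) ψ = spinA ψ := by
  rw [gamma_zero_mulVec, spinForm, spinA]
  apply Complex.ext <;> simp <;> ring

theorem spinForm_spatialClifford (w : Fin 3 → ℝ) (ψ : Fin 4 → ℂ) :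
    spinForm (spatialClifford w ψ) ψ = -(w ⬝ᵥ spinB ψ : ℝ) := by
  rw [spatialClifford_apply, spinForm]
  simp only [spinB, dotProduct, Fin.sum_univ_three]
  apply Complex.ext <;> simp <;> ring

theorem spinForm_add_left (u u' v : Fin 4 → ℂ) :
    spinForm (u + u') v = spinForm u v + spinForm u' v := by
  simp only [spinForm, Pi.add_apply]
  ring

theorem spinForm_smul_left (c : ℂ) (u v : Fin 4 → ℂ) :
    spinForm (c • u) v = c * spinForm u v := by
  simp only [spinForm, Pi.smul_apply, smul_eq_mul]
  ring

theorem spinForm_sub_left (u u' v : Fin 4 → ℂ) :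
    spinForm (u - u') v = spinForm u v - spinForm u' v := by
  simp only [spinForm, Pi.sub_apply]
  ring

theorem spinForm_clifford (hκ : 0 < κ) (p v : Static) (ψ : Fin 4 → ℂ) :
    spinForm (clifford κ p v ψ) ψ = ((lapse κ p * v.1 * spinA ψ - v.2 ⬝ᵥ spinB ψ +
      κ * (p.2 ⬝ᵥ v.2) / (lapse κ p * (1 + lapse κ p)) * (p.2 ⬝ᵥ spinB ψ) : ℝ) : ℂ) := by
  rw [clifford_eq hκ, spinForm_sub_left, spinForm_add_left, spinForm_smul_left,
    spinForm_smul_left, spinForm_gamma_zero, spinForm_spatialClifford, spinForm_spatialClifford]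
  push_cast
  ring

/-- The operator `c + i m x.` is Hermitian because `x.` is anti-Hermitian, and `(i m x.)² = m²
|x|²`; the cross term is the bilinear `C`. -/
theorem spinA_spinBoost (c m : ℝ) (x : Fin 3 → ℝ) (φ : Fin 4 → ℂ) :
    spinA (spinBoost c m x φ) =
      (c ^ 2 + m ^ 2 * (x ⬝ᵥ x)) * spinA φ + 2 * c * m * (x ⬝ᵥ spinC φ) := by
  simp only [spinBoost, spatialClifford_apply, spinA, spinC, dotProduct, Fin.sum_univ_three]
  simp
  ring

theorem spinB_spinBoost (c m : ℝ) (x : Fin 3 → ℝ) (φ : Fin 4 → ℂ) :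
    spinB (spinBoost c m x φ) = (c ^ 2 + m ^ 2 * (x ⬝ᵥ x)) • spinB φ +
      (2 * c * m) • (spinD φ ⨯₃ x) - (2 * m ^ 2 * (x ⬝ᵥ spinB φ)) • x := by
  simp only [spinBoost, spatialClifford_apply, spinB, spinD, crossProduct, dotProduct,
    Fin.sum_univ_three]
  ext i
  fin_cases i <;> simp <;> ring

/-- The Killing field of the imaginary Killing spinor with value `s` at the origin. -/
def spinorSquare (κ : ℝ) (s : Fin 4 → ℂ) : so32 :=
  √κ • coord (spinA s) (spinB s) (spinC s) (spinD s)

/-- The rotation and boost formulas express the bilinears at every point through those of `s`; the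
result is compared with the linear field on the whole chart. -/
theorem spinorSquare_mem_spinorSet (hκ : 0 < κ) (s : Fin 4 → ℂ) :
    spinorSquare κ s ∈ spinorSet κ := by
  refine ⟨field_isKilling κ _, killingSpinor κ s, isKillingSpinor_killingSpinor hκ s, ?_⟩
  intro y p v hp
  rw [spinForm_clifford hκ, killingSpinor, spinA_spinBoost, spinB_spinBoost, spinA_spinRotation,
    spinB_spinRotation, spinC_spinRotation, spinD_spinRotation, spinorSquare, map_smul,
    Pi.smul_apply, field_coord, ← hp, fderiv_chart hκ, ← Complex.ofReal_neg, Complex.ofReal_inj]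
  generalize spinA s = A
  generalize spinB s = B
  generalize spinC s = C
  generalize spinD s = D
  have hL := lapse_pos hκ p
  have hc := halfCosh_pos hκ p
  have hLc := lapse_eq_halfCosh hκ p
  have hr := kappa_mul_sq_eq_halfCosh hκ p
  have hk : κ = √κ ^ 2 := (Real.sq_sqrt hκ.le).symm
  have hσ : √κ ≠ 0 := (Real.sqrt_pos.2 hκ).ne'
  have hcs := Real.sin_sq_add_cos_sq (√κ * p.1)
  have hmm : halfCosh κ p ^ 2 + (√κ / (2 * halfCosh κ p)) ^ 2 * (p.2 ⬝ᵥ p.2) = lapse κ p := by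
    rw [hLc]
    simp only [dotProduct, Fin.sum_univ_three, ← sq]
    rw [div_pow, ← hk]
    field_simp
    linarith
  have hm1 : 2 * halfCosh κ p * (√κ / (2 * halfCosh κ p)) = √κ := by field_simp
  have hm2 : 2 * (√κ / (2 * halfCosh κ p)) ^ 2 = κ / (1 + lapse κ p) := by
    rw [div_pow, ← hk, hLc]
    field_simp
    ring
  have hLs : lapse κ p ^ 2 = 1 + κ * (p.2 0 ^ 2 + p.2 1 ^ 2 + p.2 2 ^ 2) := by
    rw [lapse_sq hκ, Fin.sum_univ_three]
  -- As `κ r² = L² - 1` for the lapse `L`, the radial component is multiplied by `L - (L - 1) = 1`.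
  have hx : p.2 ⬝ᵥ (lapse κ p • (Real.cos (√κ * p.1) • B + Real.sin (√κ * p.1) • C) +
      √κ • (D ⨯₃ p.2) - (κ / (1 + lapse κ p) *
        (p.2 ⬝ᵥ (Real.cos (√κ * p.1) • B + Real.sin (√κ * p.1) • C))) • p.2) =
      p.2 ⬝ᵥ (Real.cos (√κ * p.1) • B + Real.sin (√κ * p.1) • C) := by
    rw [dotProduct_sub, dotProduct_add, dotProduct_smul, dotProduct_smul, dotProduct_smul,
      dot_cross_self]
    generalize p.2 ⬝ᵥ (Real.cos (√κ * p.1) • B + Real.sin (√κ * p.1) • C) = b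
    have hxx : p.2 ⬝ᵥ p.2 = p.2 0 ^ 2 + p.2 1 ^ 2 + p.2 2 ^ 2 := by
      simp only [dotProduct, Fin.sum_univ_three, ← sq]
    rw [hxx]
    simp only [smul_eq_mul]
    field_simp
    linear_combination b * hLs
  have hf : κ / (1 + lapse κ p) + κ / (lapse κ p * (1 + lapse κ p)) = κ / lapse κ p := by
    field_simp
    ring
  have hn : √κ * (lapse κ p / √κ) = lapse κ p := by field_simp
  rw [hmm, hm1, hm2, hx]
  simp only [chart]
  generalize lapse κ p / √κ = n at *
  generalize lapse κ p = L at *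
  generalize Real.cos (√κ * p.1) = co at *
  generalize Real.sin (√κ * p.1) = si at *
  simp [eta_apply, coordVector, crossProduct, dotProduct, Fin.sum_univ_three, Matrix.vecHead,
    Matrix.vecTail]
  linear_combination
    ((co * B 0 + si * C 0) * v.2 0 + (co * B 1 + si * C 1) * v.2 1 + (co * B 2 + si * C 2) * v.2 2 -
      A * L * v.1 * (si ^ 2 + co ^ 2)) * hn - A * L ^ 2 * v.1 * hcs +
    (p.2 0 * (co * B 0 + si * C 0) + p.2 1 * (co * B 1 + si * C 1) +
      p.2 2 * (co * B 2 + si * C 2)) * (p.2 0 * v.2 0 + p.2 1 * v.2 1 + p.2 2 * v.2 2) *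
      (hf + L⁻¹ * hk)

/-! ### Convex combinations of squares of Majorana spinors -/

/-- The Majorana spinor with real components `v`. -/
def majorana (v : Fin 4 → ℝ) : Fin 4 → ℂ :=
  ![⟨v 0, v 1⟩, ⟨v 2, v 3⟩, ⟨v 2, -v 3⟩, ⟨-v 0, v 1⟩]

/-- The square of the Majorana spinor `v`, as an element of `so(3,2)`. -/
def majoranaSquare (v : Fin 4 → ℝ) : so32 :=
  coord (majoranaA v) (majoranaB v) (majoranaC v) (majoranaD v)

/-- A Majorana spinor has the shape `(a, b, b̄, -ā)`, so each modulus occurs twice; hence the factor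
`2` in the normalization of `l`. -/
theorem spinorSquare_smul_majorana {l : ℝ} (hl : 2 * √κ * l ^ 2 = 1) (v : Fin 4 → ℝ) :
    spinorSquare κ ((l : ℂ) • majorana v) = majoranaSquare v := by
  apply so32_ext
  · simp only [spinorSquare, majoranaSquare, map_smul, coordA_coord, spinA, majorana, majoranaA]
    simp
    linear_combination (v 0 ^ 2 + v 1 ^ 2 + v 2 ^ 2 + v 3 ^ 2) * hl
  · simp only [spinorSquare, majoranaSquare, map_smul, coordB_coord, spinB, majorana, majoranaB]
    ext i
    fin_cases i <;> simp
    · linear_combination (v 0 ^ 2 + v 1 ^ 2 - v 2 ^ 2 - v 3 ^ 2) * hl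
    · linear_combination (2 * (v 0 * v 2 + v 1 * v 3)) * hl
    · linear_combination (2 * (v 0 * v 3 - v 1 * v 2)) * hl
  · simp only [spinorSquare, majoranaSquare, map_smul, coordC_coord, spinC, majorana, majoranaC]
    ext i
    fin_cases i <;> simp
    · linear_combination (2 * (v 0 * v 3 + v 1 * v 2)) * hl
    · linear_combination (2 * (v 2 * v 3 - v 0 * v 1)) * hl
    · linear_combination (-(v 0 ^ 2 - v 1 ^ 2 + v 2 ^ 2 - v 3 ^ 2)) * hl
  · simp only [spinorSquare, majoranaSquare, map_smul, coordD_coord, spinD, majorana, majoranaD]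
    ext i
    fin_cases i <;> simp
    · linear_combination (2 * (v 0 * v 2 - v 1 * v 3)) * hl
    · linear_combination (v 2 ^ 2 - v 3 ^ 2 - v 0 ^ 2 + v 1 ^ 2) * hl
    · linear_combination (2 * (v 0 * v 1 + v 2 * v 3)) * hl

theorem majoranaSquare_mem_spinorSet (hκ : 0 < κ) (v : Fin 4 → ℝ) :
    majoranaSquare v ∈ spinorSet κ := by
  have hs := Real.sqrt_pos.2 hκ
  have hl : 2 * √κ * √((2 * √κ)⁻¹) ^ 2 = 1 := by
    rw [Real.sq_sqrt (by positivity)]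
    field_simp
  rw [← spinorSquare_smul_majorana hl]
  exact spinorSquare_mem_spinorSet hκ _

/-- The symmetric matrix of the quadratic form `v ↦ majoranaPairing v M`. -/
def majoranaMatrix (M : so32) : Matrix (Fin 4) (Fin 4) ℝ :=
  let A := coordA M
  let B := coordB M
  let C := coordC M
  let D := coordD M
  !![A + B 0 - C 2 - D 1, D 2 - C 1, B 1 + D 0, B 2 + C 0;
    D 2 - C 1, A + B 0 + C 2 + D 1, C 0 - B 2, B 1 - D 0;
    B 1 + D 0, C 0 - B 2, A - B 0 - C 2 + D 1, C 1 + D 2;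
    B 2 + C 0, B 1 - D 0, C 1 + D 2, A - B 0 + C 2 - D 1]

theorem dotProduct_majoranaMatrix_mulVec (M : so32) (v : Fin 4 → ℝ) :
    v ⬝ᵥ (majoranaMatrix M *ᵥ v) = majoranaPairing v M := by
  simp only [majoranaMatrix, majoranaPairing, majoranaA, majoranaB, majoranaC, majoranaD]
  simp [dotProduct, Matrix.mulVec, Fin.sum_univ_four, Fin.sum_univ_three]
  ring

open scoped MatrixOrder in
theorem exists_majoranaMatrix_eq (M : so32) (h : ∀ v, 0 ≤ majoranaPairing v M) :
    ∃ R : Matrix (Fin 4) (Fin 4) ℝ, majoranaMatrix M = Rᵀ * R := by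
  have hp : (majoranaMatrix M).PosSemidef := by
    refine Matrix.PosSemidef.of_dotProduct_mulVec_nonneg ?_ fun v => ?_
    · ext i j
      fin_cases i <;> fin_cases j <;> rfl
    · rw [star_trivial, dotProduct_majoranaMatrix_mulVec]
      exact h v
  obtain ⟨R, hR⟩ := CStarAlgebra.nonneg_iff_eq_star_mul_self.mp hp.nonneg
  refine ⟨R, ?_⟩
  rw [hR, Matrix.star_eq_conjTranspose, Matrix.conjTranspose_eq_transpose_of_trivial]

/-- An element of `so(3,2)` whose pairings with squares of Majorana spinors are nonnegative is
itself a mean of such squares. -/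
theorem eq_sum_majoranaSquare {M : so32} (h : ∀ v, 0 ≤ majoranaPairing v M) :
    ∃ v : Fin 4 → Fin 4 → ℝ, M = ∑ k, (1 / 4 : ℝ) • majoranaSquare (v k) := by
  obtain ⟨R, hR⟩ := exists_majoranaMatrix_eq M h
  have hij : ∀ i j, majoranaMatrix M i j = ∑ k, R k i * R k j := fun i j => by
    rw [hR]
    rfl
  have h00 := hij 0 0
  have h11 := hij 1 1
  have h22 := hij 2 2
  have h33 := hij 3 3
  have h01 := hij 0 1
  have h02 := hij 0 2
  have h03 := hij 0 3
  have h12 := hij 1 2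
  have h13 := hij 1 3
  have h23 := hij 2 3
  simp [majoranaMatrix, Fin.sum_univ_four] at h00 h11 h22 h33 h01 h02 h03 h12 h13 h23
  -- The rows of `R` are the required spinors: the matrix of `majoranaSquare v` is `4 v vᵀ`, whence
  -- the weights `1 / 4`. The matrix entries determine all ten coordinates.
  refine ⟨fun k => R k, ?_⟩
  apply so32_ext
  · simp only [Fin.sum_univ_four, map_add, map_smul, majoranaSquare, coordA_coord]
    simp only [majoranaA, smul_eq_mul]
    linarith
  · ext i
    simp only [Fin.sum_univ_four, map_add, map_smul, majoranaSquare, coordB_coord]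
    simp only [majoranaB]
    fin_cases i <;> simp <;> linarith
  · ext i
    simp only [Fin.sum_univ_four, map_add, map_smul, majoranaSquare, coordC_coord]
    simp only [majoranaC]
    fin_cases i <;> simp <;> linarith
  · ext i
    simp only [Fin.sum_univ_four, map_add, map_smul, majoranaSquare, coordD_coord]
    simp only [majoranaD]
    fin_cases i <;> simp <;> linarith

theorem majoranaPairing_zero (M : so32) : majoranaPairing 0 M = 0 := by
  rw [← dotProduct_majoranaMatrix_mulVec, zero_dotProduct]

theorem eq_sum_of_mem_observerSet (hκ : 0 < κ) {M : so32} (hM : M ∈ observerSet κ) :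
    ∃ L : Fin 4 → so32, (∀ k, L k ∈ spinorSet κ) ∧ M = ∑ k, (1 / 4 : ℝ) • L k := by
  obtain ⟨v, hv⟩ := eq_sum_majoranaSquare (M := M) fun v => by
    rcases eq_or_ne v 0 with rfl | h
    · exact (majoranaPairing_zero M).ge
    · exact (majoranaPairing_pos_of_mem_observerSet hκ hM h).le
  exact ⟨fun k => majoranaSquare (v k), fun k => majoranaSquare_mem_spinorSet hκ (v k), hv⟩

theorem observerSet_subset_convexHull_spinorSet (hκ : 0 < κ) :
    observerSet κ ⊆ convexHull ℝ (spinorSet κ) := fun M hM => by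
  obtain ⟨L, hL, rfl⟩ := eq_sum_of_mem_observerSet hκ hM
  exact (convex_convexHull ℝ _).sum_mem (fun _ _ => by norm_num) (by norm_num)
    fun k _ => subset_convexHull ℝ _ (hL k)

/-! ### A spinor Killing field outside the convex hull of the observer Killing fields -/

theorem coord_mem_spinorSet (hκ : 0 < κ) :
    coord 3 ![-1, 0, 0] ![-2, 0, 0] ![2, 0, 0] ∈ spinorSet κ := by
  have hs := Real.sqrt_pos.2 hκ
  have hl : √κ * √((√κ)⁻¹) ^ 2 = 1 := by
    rw [Real.sq_sqrt (by positivity)]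
    field_simp
  -- The spinor `(1, 0, 1 + i, 0)` has exactly the prescribed bilinears; the scalar cancels the
  -- factor `√κ`.
  convert spinorSquare_mem_spinorSet hκ ((√((√κ)⁻¹) : ℂ) • ![1, 0, ⟨1, 1⟩, 0]) using 1
  generalize √((√κ)⁻¹) = l at *
  apply so32_ext
  · simp only [spinorSquare, map_smul, coordA_coord, spinA]
    simp
    linear_combination -3 * hl
  · ext i
    simp only [spinorSquare, map_smul, coordB_coord, spinB]
    fin_cases i <;> simp
    linarith
  · ext i
    simp only [spinorSquare, map_smul, coordC_coord, spinC]
    fin_cases i <;> simp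
    linarith
  · ext i
    simp only [spinorSquare, map_smul, coordD_coord, spinD]
    fin_cases i <;> simp
    linarith

theorem coord_notMem_convexHull_observerSet (hκ : 0 < κ) :
    coord 3 ![-1, 0, 0] ![-2, 0, 0] ![2, 0, 0] ∉ convexHull ℝ (observerSet κ) := by
  intro h
  -- This vector spans a null direction of the form of the given field: the pairing is `9 - 1 - 4 -
  -- 4 = 0`.
  have hv : (![-1, 1, 1, 0] : Fin 4 → ℝ) ≠ 0 := fun h0 => by simpa using congrFun h0 1
  have := convexHull_min (fun M hM => majoranaPairing_pos_of_mem_observerSet hκ hM hv)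
    (convex_halfSpace_gt (isLinearMap_majoranaPairing ![-1, 1, 1, 0]) 0) h
  change 0 < majoranaPairing _ _ at this
  rw [majoranaPairing, coordA_coord, coordB_coord, coordC_coord, coordD_coord] at this
  simp [majoranaA, majoranaB, majoranaC, majoranaD] at this
  norm_num at this

end AdS

end

theorem theorem1p4 (κ : ℝ) (hκ : 0 < κ) :
    -- the space of Killing fields is identified with `so(3,2)`
    Set.BijOn (AdS.field κ) Set.univ {V | AdS.IsKilling κ V} ∧
    -- the convex hull of `𝒪` is properly contained in the convex hull of `𝒮`
    convexHull ℝ (AdS.observerSet κ) ⊂ convexHull ℝ (AdS.spinorSet κ) ∧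
    -- every observer Killing field is a positive combination of spinor Killing fields
    (∀ K ∈ AdS.observerSet κ, ∃ (n : ℕ) (c : Fin n → ℝ) (L : Fin n → AdS.so32),
      (∀ i, 0 < c i ∧ L i ∈ AdS.spinorSet κ) ∧ K = ∑ i, c i • L i) ∧
    -- an explicit spinor Killing field outside the convex hull of `𝒪`
    AdS.coord 3 ![-1, 0, 0] ![-2, 0, 0] ![2, 0, 0] ∈ AdS.spinorSet κ ∧
    AdS.coord 3 ![-1, 0, 0] ![-2, 0, 0] ![2, 0, 0] ∉ convexHull ℝ (AdS.observerSet κ) := by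
  have hmem := AdS.coord_mem_spinorSet hκ
  have hnot := AdS.coord_notMem_convexHull_observerSet hκ
  refine ⟨AdS.bijOn_field hκ, ⟨?_, fun h => ?_⟩, fun K hK => ?_, hmem, hnot⟩
  · exact convexHull_min (AdS.observerSet_subset_convexHull_spinorSet hκ) (convex_convexHull ℝ _)
  · exact hnot (h (subset_convexHull ℝ _ hmem))
  · obtain ⟨L, hL, hK⟩ := AdS.eq_sum_of_mem_observerSet hκ hK
    exact ⟨4, fun _ => 1 / 4, L, fun i => ⟨by norm_num, hL i⟩, hK⟩
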